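/- Let $\rho, V \in L^\infty(\mathbb{R}^+\times\mathbb{R};\mathbb{R}^+)$, $\mathbb{R}^+=[0,\infty)$, be such that the field $(\rho,\rho V)$ is divergence free, i.e. $\partial_t\rho+\partial_x(\rho V)=0$ in the sense of distributions on $(0,\infty)\times\mathbb{R}$, and denote by $\rho(0,\cdot)\in L^\infty(\mathbb{R})$ its initial trace, which is characterized by $$\int_0^\infty\!\!\int_{\mathbb{R}} \bigl(\rho\,\partial_t\phi+\rho V\,\partial_x\phi\bigr)\,dx\,dt+\int_{\mathbb{R}}\rho(0,x)\,\phi(0,x)\,dx=0\qquad\text{for all }\phi\in C_c^\infty(\mathbb{R}^+\times\mathbb{R}).$$ Let $w_o:\mathbb{R}\to[0,1]$ be piecewise constant: there are $M\ge 1$, reals $d_1<\dots<d_M$ and values $a_0,\dots,a_M\in[0,1]$ with $w_o=a_0$ on $(-\infty,d_1)$, $w_o=a_m$ on $[d_m,d_{m+1})$ for $1\le m\le M-1$, and $w_o=a_M$ on $[d_M,\infty)$. A weak solution of $$\partial_t(\rho w)+\partial_x(\rho V w)=0,\qquad w(0,\cdot)=w_o,$$ is a function $w\in L^\infty(\mathbb{R}^+\times\mathbb{R})$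 such that for all $\phi\in C_c^\infty(\mathbb{R}^+\times\mathbb{R})$ $$\int_0^\infty\!\!\int_{\mathbb{R}} \bigl(\rho w\,\partial_t\phi+\rho V w\,\partial_x\phi\bigr)\,dx\,dt+\int_{\mathbb{R}}\rho(0,x)\,w_o(x)\,\phi(0,x)\,dx=0.$$ Then there is a weak solution $w$, it is unique in the sense that any other weak solution agrees with it almost everywhere on $\{\rho\neq 0\}$, and it can be chosen piecewise constant in the following sense: there exist times $0\le t_m<T_m\le\infty$ and Lipschitz curves $y_m:[t_m,T_m)\to\mathbb{R}$, $1\le m\le M$, ordered in the sense that $y_m(s)<y_n(s)$ whenever $m<n$ and $s\in[t_m,T_m)\cap[t_n,T_n)$, such that, with $\Gamma_m=\{(s,y_m(s)) : s\in[t_m,T_m)\}$, $w$ is constant on each connected component of $(\mathbb{R}^+\times\mathbb{R})\setminus\bigcup_{m=1}^M\Gamma_m$. -/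

import Mathlib

open MeasureTheory Set
open scoped ContDiff

/-- The closed half-plane `[0, ∞) × ℝ` of points `(t, x)`. -/
def halfPlane : Set (ℝ × ℝ) := Ici 0 ×ˢ univ

/-- Elements of `L^∞([0, ∞) × ℝ, ℝ)`, given by representatives. -/
def IsBoundedField (u : ℝ × ℝ → ℝ) : Prop :=
  MemLp u ⊤ (volume.restrict halfPlane)

/-- Test functions on `ℝ × ℝ`. Their restrictions to the half-plane are the elements of
`C_c^∞([0, ∞) × ℝ)`, which need not vanish on the line `t = 0`. -/
def IsTestFunction (φ : ℝ × ℝ → ℝ) : Prop :=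
  ContDiff ℝ ∞ φ ∧ HasCompactSupport φ

/-- `∫_0^∞ ∫_ℝ (g ∂_t φ + G ∂_x φ) dx dt`. -/
noncomputable def divPairing (g G φ : ℝ × ℝ → ℝ) : ℝ :=
  ∫ p in halfPlane, (g p * fderiv ℝ φ p (1, 0) + G p * fderiv ℝ φ p (0, 1))

/-- `∂_t ρ + ∂_x (ρ V) = 0` in the sense of distributions on the open half-plane. -/
def IsDivergenceFree (ρ V : ℝ × ℝ → ℝ) : Prop :=
  ∀ φ : ℝ × ℝ → ℝ, IsTestFunction φ → tsupport φ ⊆ Ioi 0 ×ˢ univ →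
    divPairing ρ (fun p => ρ p * V p) φ = 0

/-- `ρ₀` is the initial trace `ρ(0, ·)` of the divergence-free field `(ρ, ρV)`, in the sense of
Green's formula. This determines `ρ₀` almost everywhere. -/
def IsInitialTrace (ρ V : ℝ × ℝ → ℝ) (ρ₀ : ℝ → ℝ) : Prop :=
  MemLp ρ₀ ⊤ volume ∧
    ∀ φ : ℝ × ℝ → ℝ, IsTestFunction φ →
      divPairing ρ (fun p => ρ p * V p) φ + ∫ x, ρ₀ x * φ (0, x) = 0

/-- `w` is a weak solution of `∂_t (ρ w) + ∂_x (ρ V w) = 0`, `w(0, ·) = w₀`. -/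
def IsWeakSolution (ρ V : ℝ × ℝ → ℝ) (w₀ : ℝ → ℝ) (w : ℝ × ℝ → ℝ) : Prop :=
  IsBoundedField w ∧ ∃ ρ₀ : ℝ → ℝ, IsInitialTrace ρ V ρ₀ ∧
    ∀ φ : ℝ × ℝ → ℝ, IsTestFunction φ →
      divPairing (fun p => ρ p * w p) (fun p => ρ p * V p * w p) φ
        + ∫ x, ρ₀ x * w₀ x * φ (0, x) = 0

/-- `w₀` is the step function with jump points `d 0 < ⋯ < d (M - 1)` and values `a 0, …, a M`
in `[0, 1]`: it equals `a 0` on `(-∞, d 0)`, `a m` on `[d (m - 1), d m)` for `0 < m < M`,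
and `a M` on `[d (M - 1), ∞)`. -/
structure IsStepFunction {M : ℕ} (d : Fin M → ℝ) (a : Fin (M + 1) → ℝ) (w₀ : ℝ → ℝ) : Prop where
  ordered : StrictMono d
  values_mem : ∀ m, a m ∈ Icc (0 : ℝ) 1
  eq_value : ∀ (m : Fin (M + 1)) (x : ℝ),
    (∀ i : Fin M, i.castSucc < m → d i ≤ x) → (∀ i : Fin M, m ≤ i.castSucc → x < d i) →
      w₀ x = a m

/-- The time interval `[t, T)`, where `T = ∞` is allowed. -/
def timeInterval (t : ℝ) (T : EReal) : Set ℝ := {s | t ≤ s ∧ (s : EReal) < T}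

/-- The curve `Γ = {(s, y s) : s ∈ [t, T)}`. -/
def curve (t : ℝ) (T : EReal) (y : ℝ → ℝ) : Set (ℝ × ℝ) :=
  (fun s => (s, y s)) '' timeInterval t T

/-- Lipschitz curves `y m` on nonempty time intervals `[t m, T m)`, with `0 ≤ t m < T m ≤ ∞`, which
are strictly ordered at all common times. -/
structure IsOrderedLipschitzFamily {M : ℕ} (t : Fin M → ℝ) (T : Fin M → EReal)
    (y : Fin M → ℝ → ℝ) : Prop where
  start_nonneg : ∀ m, 0 ≤ t m
  start_lt_stop : ∀ m, (t m : EReal) < T m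
  lipschitz : ∀ m, ∃ K, LipschitzOnWith K (y m) (timeInterval (t m) (T m))
  ordered : ∀ m n, m < n → ∀ s ∈ timeInterval (t m) (T m) ∩ timeInterval (t n) (T n), y m s < y n s

/-- `w` is constant on each connected component of `S`. -/
def IsConstantOnComponents (S : Set (ℝ × ℝ)) (w : ℝ × ℝ → ℝ) : Prop :=
  ∀ p ∈ S, ∀ q ∈ connectedComponentIn S p, w q = w p

/-! A divergence-free field in the plane is a rotated gradient: there is a Lipschitz stream function
`H` with `∂_x H = ρ` and `∂_t H = -ρV` (`exists_isStreamFunction`). The equation says formally that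
`w` is transported along the level sets of `H`, so `w` should be a function of `H`.

Existence. For continuous `f` with antiderivative `F`, the field `f(H)∇H = ∇(F ∘ H)` is again a
gradient, so `f(H)` solves the equation. Pointwise limits extend this to step functions
(`IsStreamFunction.divPairing_add_eq_zero`). Placing the jumps of `f` at the values `H(0, d_i)`
gives the datum `w₀` wherever the initial density is nonzero.

Uniqueness. The difference `v` of two solutions makes `(ρv, ρVv)` divergence free with zero trace,
so this field has a stream function `K` vanishing at time 0. Since `∇K = v∇H`, functions of `K` are
transported as well. Testing with a cutoff that strictly decreases along characteristics forces `K =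
0`, hence `ρv = 0` (`IsStreamFunction.ae_mul_eq_zero`).

Structure. The signs `ρ ≥ 0` and `0 ≤ V ≤ L` make `H` nondecreasing in `x`, nonincreasing in `t` and
nondecreasing along lines of speed `L`. So each set `{H ≥ h}` is the region to the right of a
Lipschitz graph (`exists_level_curve`), unless it is everything. Coinciding or missing curves are
replaced by harmless extra ones to obtain strict ordering (`exists_ordered_family`); removing
additional curves only shrinks the components on which `w` must be constant. -/

open Filter Topology NNReal
open scoped Convolution

/-! ### Lipschitz functions: symmetry of weak second derivatives, monotonicity along directions. -/

section LipschitzCalculus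

variable {E : Type*} [NormedAddCommGroup E] [NormedSpace ℝ E] [FiniteDimensional ℝ E]
  [MeasurableSpace E] [BorelSpace E] {μ : Measure E} [μ.IsAddHaarMeasure]

theorem lineDeriv_eq_zero_of_notMem_tsupport {E : Type*} [NormedAddCommGroup E] [NormedSpace ℝ E]
    {g : E → ℝ} {x : E} (hx : x ∉ tsupport g) (v : E) : lineDeriv ℝ g x v = 0 := by
  have h0 : g =ᶠ[𝓝 x] fun _ => 0 := notMem_tsupport_iff_eventuallyEq.1 hx
  rw [h0.lineDeriv_eq]
  simp [lineDeriv]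

theorem HasCompactSupport.lineDeriv {E : Type*} [NormedAddCommGroup E] [NormedSpace ℝ E]
    {g : E → ℝ} (hc : HasCompactSupport g) (v : E) :
    HasCompactSupport (fun x => lineDeriv ℝ g x v) :=
  hc.mono' fun x hx => by
    by_contra h
    exact hx (lineDeriv_eq_zero_of_notMem_tsupport h v)

theorem LipschitzWith.integrable_lineDeriv {C : ℝ≥0} {g : E → ℝ} (hg : LipschitzWith C g)
    (hc : HasCompactSupport g) (v : E) : Integrable (fun x => lineDeriv ℝ g x v) μ := by
  have h1 := hg.locallyIntegrable_lineDeriv (μ := μ) v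
  have h2 := hc.lineDeriv v
  exact (integrable_iff_integrableAtFilter_cocompact.2
    ⟨⟨_, (hasCompactSupport_def.1 h2 |> fun h => h.compl_mem_cocompact), by
      refine IntegrableOn.congr_fun (f := fun _ => 0) (by simp) ?_
        (isClosed_tsupport _).isOpen_compl.measurableSet
      intro x hx
      exact (image_eq_zero_of_notMem_tsupport hx).symm⟩, h1⟩)

/-- Weak form of the symmetry of second derivatives for Lipschitz functions. -/
theorem LipschitzWith.integral_lineDeriv_mul_lineDeriv_comm {C D : ℝ≥0} {f g : E → ℝ}
    (hf : LipschitzWith C f) (hg : LipschitzWith D g) (hc : HasCompactSupport g) (v w : E) :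
    ∫ x, lineDeriv ℝ f x v * lineDeriv ℝ g x w ∂μ
      = ∫ x, lineDeriv ℝ f x w * lineDeriv ℝ g x v ∂μ := by
  set u : E → ℝ := fun x => lineDeriv ℝ f x w with hu
  have hum : Measurable u := measurable_lineDeriv hf.continuous
  -- `K` contains the supports of all translates of `g` by `t • v` with `0 < t ≤ 1`, so truncating
  -- `u` to `K` makes it integrable without changing any integral below.
  let K := Metric.cthickening ‖v‖ (tsupport g)
  have hK : IsCompact K := IsCompact.cthickening hc
  have huK : Integrable (K.indicator u) μ :=
    ((hf.locallyIntegrable_lineDeriv w).integrableOn_isCompact hK).integrable_indicator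
      hK.isClosed.measurableSet
  -- Both sides are limits of difference quotients in direction `v`, falling on `f` in `A` and on
  -- `g` in `B`. For fixed `t` they agree after integrating by parts in direction `w` and
  -- translating.
  have A := hf.integral_inv_smul_sub_mul_tendsto_integral_lineDeriv_mul
    (hg.integrable_lineDeriv (μ := μ) hc w) v
  have B := (hg.integral_inv_smul_sub_mul_tendsto_integral_lineDeriv_mul huK (-v)).neg
  refine (tendsto_nhds_unique A (B.congr' ?_)).trans ?_
  · filter_upwards [Ioc_mem_nhdsGT zero_lt_one] with t ht
    -- the difference quotient is Lipschitz
    have hF : ∃ C', LipschitzWith C' (fun x => t⁻¹ • (f (x + t • v) - f x)) := by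
      have h0 := (hf.comp ((LipschitzWith.id.add (LipschitzWith.const (t • v))))).sub hf
      exact ⟨_, (lipschitzWith_smul t⁻¹).comp h0⟩
    obtain ⟨C', hF⟩ := hF
    have h1 := hF.integral_lineDeriv_mul_eq (μ := μ) hg hc w
    have h2 : ∀ᵐ x ∂μ, lineDeriv ℝ (fun x => t⁻¹ • (f (x + t • v) - f x)) x w
        = t⁻¹ * (u (x + t • v) - u x) := by
      have d1 := hf.ae_lineDifferentiableAt (μ := μ) w
      have d2 := (measurePreserving_add_right μ (t • v)).quasiMeasurePreserving.ae d1
      filter_upwards [d1, d2] with x hx1 hx2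
      have e1 : HasLineDerivAt ℝ f (u x) x w := hx1.hasLineDerivAt
      have e2 : HasLineDerivAt ℝ f (u (x + t • v)) (x + t • v) w := hx2.hasLineDerivAt
      have e3 : HasLineDerivAt ℝ (fun x => f (x + t • v)) (u (x + t • v)) x w := by
        unfold HasLineDerivAt at e2 ⊢
        convert e2 using 2
        abel_nf
      exact HasLineDerivAt.lineDeriv (((e3.sub e1).const_mul t⁻¹ : HasDerivAt _ _ _))
    have h3 : ∫ x, lineDeriv ℝ (fun x => t⁻¹ • (f (x + t • v) - f x)) x w * g x ∂μ
        = ∫ x, t⁻¹ * (u (x + t • v) - u x) * g x ∂μ :=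
      integral_congr_ae (h2.mono fun x hx => by simp only [hx])
    have h4 : ∫ x, t⁻¹ • (f (x + t • v) - f x) * lineDeriv ℝ g x w ∂μ
        = - ∫ x, t⁻¹ * (u (x + t • v) - u x) * g x ∂μ := by
      rw [← h3, h1, ← integral_neg]
      congr 1; ext x; rw [lineDeriv_neg]; ring
    rw [h4]
    congr 1
    -- discrete integration by parts
    have hub : ∀ x, ‖u x‖ ≤ C * ‖w‖ := fun x => norm_lineDeriv_le_of_lipschitz ℝ hf
    have hgi : Integrable g μ := hg.continuous.integrable_of_hasCompactSupport hc
    have i1 : Integrable (fun x => u (x + t • v) * g x) μ :=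
      hgi.bdd_mul (hum.comp (measurable_id.add_const _)).aestronglyMeasurable
        (Eventually.of_forall fun x => hub _)
    have i2 : Integrable (fun x => u x * g x) μ :=
      hgi.bdd_mul hum.aestronglyMeasurable (Eventually.of_forall fun x => hub _)
    have i3 : Integrable (fun x => u x * g (x + t • (-v))) μ :=
      (hgi.comp_add_right (t • (-v))).bdd_mul hum.aestronglyMeasurable
        (Eventually.of_forall fun x => hub _)
    have e1 : ∫ x, u (x + t • v) * g x ∂μ = ∫ x, u x * g (x + t • (-v)) ∂μ := by
      rw [← integral_add_right_eq_self (fun x => u x * g (x + t • (-v))) (t • v)]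
      congr 1; ext x; simp
    calc ∫ x, t⁻¹ • (g (x + t • (-v)) - g x) * K.indicator u x ∂μ
        = ∫ x, t⁻¹ * (u x * g (x + t • (-v)) - u x * g x) ∂μ := by
          congr 1; ext x
          by_cases hx : x ∈ K
          · simp only [indicator_of_mem hx, smul_eq_mul]; ring
          · have g1 : g x = 0 := image_eq_zero_of_notMem_tsupport fun h =>
              hx (Metric.self_subset_cthickening _ h)
            have g2 : g (x + t • (-v)) = 0 := image_eq_zero_of_notMem_tsupport fun h => hx (by
              refine Metric.mem_cthickening_of_dist_le _ _ _ _ h ?_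
              simp only [smul_neg, dist_eq_norm]
              rw [show x - (x + -(t • v)) = t • v by abel, norm_smul, Real.norm_of_nonneg ht.1.le]
              exact mul_le_of_le_one_left (norm_nonneg _) ht.2)
            simp only [g1, g2]; ring
      _ = ∫ x, t⁻¹ * (u (x + t • v) * g x - u x * g x) ∂μ := by
          rw [integral_const_mul, integral_const_mul, integral_sub i3 i2, integral_sub i1 i2, e1]
      _ = _ := by congr 1; ext x; ring
  · rw [← integral_neg]
    congr 1; ext x
    rw [lineDeriv_neg]
    by_cases hx : x ∈ K
    · simp only [indicator_of_mem hx]; ring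
    · rw [lineDeriv_eq_zero_of_notMem_tsupport
        (fun h => hx (Metric.self_subset_cthickening _ h)) v]
      simp

/-- A Lipschitz function is nondecreasing in a direction in which its derivative is a.e.
nonnegative. -/
theorem LipschitzWith.le_of_ae_lineDeriv_nonneg {C : ℝ≥0} {f : E → ℝ} (hf : LipschitzWith C f)
    {U : Set E} (hU : IsOpen U) (hconv : Convex ℝ U) {v : E}
    (h : ∀ᵐ q ∂μ, q ∈ U → 0 ≤ lineDeriv ℝ f q v) {p : E} (hp : p ∈ U) (hpv : p + v ∈ U) :
    f p ≤ f (p + v) := by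
  obtain ⟨N, hNsub, hNm, hN⟩ := exists_measurable_superset_of_null (ae_iff.1 h)
  have hN' : ∀ q ∉ N, q ∈ U → 0 ≤ lineDeriv ℝ f q v := fun q hq => by
    by_contra h'
    exact hq (hNsub h')
  -- Fubini: for almost every base point, the line in direction `v` meets `N` in a null set of
  -- parameters.
  have h1 : ∀ᵐ p ∂μ, ∀ᵐ τ : ℝ, p + τ • v ∉ N := by
    have hm : MeasurableSet {x : ℝ × E | x.2 + x.1 • v ∉ N} :=
      (by fun_prop : Measurable fun x : ℝ × E => x.2 + x.1 • v) hNm.compl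
    refine (Measure.ae_ae_comm (p := fun (τ : ℝ) (p : E) => p + τ • v ∉ N) hm).1 ?_
    refine Eventually.of_forall fun τ => ?_
    have : ∀ᵐ q ∂μ, q ∉ N := measure_eq_zero_iff_ae_notMem.1 hN
    exact (measurePreserving_add_right μ (τ • v)).quasiMeasurePreserving.ae this
  by_contra! hlt
  -- The violation set is open, so if nonempty it contains a good base point, where the fundamental
  -- theorem of calculus gives a contradiction.
  let W : Set E := (U ∩ (fun q => q + v) ⁻¹' U) ∩ {q | f (q + v) < f q}
  have hWo : IsOpen W := (hU.inter (hU.preimage (by fun_prop))).inter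
    (isOpen_lt (hf.continuous.comp (by fun_prop)) hf.continuous)
  obtain ⟨q, hqW, hq⟩ := (Measure.dense_of_ae h1).inter_open_nonempty W hWo ⟨p, ⟨hp, hpv⟩, hlt⟩
  obtain ⟨⟨hqU, hqvU⟩, hqlt⟩ := hqW
  have hq' : ∀ᵐ τ : ℝ, q + τ • v ∉ N := hq
  set γ : ℝ → ℝ := fun τ => f (q + τ • v) with hγ
  have hγL : LipschitzWith (C * ‖v‖₊) γ := by
    refine hf.comp (LipschitzWith.of_dist_le_mul fun a b => ?_)
    rw [dist_add_left, dist_eq_norm, ← sub_smul, norm_smul, mul_comm, Real.dist_eq]; simp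
  have hAC : AbsolutelyContinuousOnInterval γ 0 1 :=
    (hγL.lipschitzOnWith (s := uIcc 0 1)).absolutelyContinuousOnInterval
  have hint := hAC.integral_deriv_eq_sub
  have hnn : 0 ≤ ∫ τ in (0 : ℝ)..1, deriv γ τ := by
    refine intervalIntegral.integral_nonneg_of_ae_restrict zero_le_one ?_
    refine (ae_restrict_iff' measurableSet_Icc).2 ?_
    filter_upwards [hq'] with τ hτ hτ01
    have hmem : q + τ • v ∈ U := hconv.add_smul_mem hqU hqvU hτ01
    have h2 := hN' _ hτ hmem
    have : lineDeriv ℝ f (q + τ • v) v = deriv γ τ := by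
      unfold lineDeriv
      have : (fun t : ℝ => f (q + τ • v + t • v)) = fun t => γ (τ + t) := by
        ext t; simp only [hγ]; congr 1; rw [add_smul, add_assoc]
      rw [this, deriv_comp_const_add, add_zero]
    simpa [this] using h2
  have hqlt' : f (q + v) < f q := hqlt
  simp only [hγ, one_smul, zero_smul, add_zero] at hint
  linarith

theorem LipschitzWith.eq_of_ae_lineDeriv_eq_zero {C : ℝ≥0} {f : E → ℝ} (hf : LipschitzWith C f)
    {U : Set E} (hU : IsOpen U) (hconv : Convex ℝ U) {v : E}
    (h : ∀ᵐ q ∂μ, q ∈ U → lineDeriv ℝ f q v = 0) {p : E} (hp : p ∈ U) (hpv : p + v ∈ U) :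
    f (p + v) = f p := by
  refine le_antisymm ?_ (hf.le_of_ae_lineDeriv_nonneg hU hconv
    (h.mono fun q hq hqU => (hq hqU).ge) hp hpv)
  have := hf.le_of_ae_lineDeriv_nonneg (μ := μ) (v := -v) hU hconv
    (h.mono fun q hq hqU => by rw [lineDeriv_neg, hq hqU, neg_zero]) hpv (by simpa using hp)
  simpa using this

end LipschitzCalculus

/-! ### Compactness and mollification. -/

/-- Arzelà–Ascoli: the values on a dense sequence lie in a compact product of intervals, and the
common Lipschitz constant carries convergence to every point. -/
theorem exists_subseq_tendsto_of_lipschitzWith {E : Type*} [NormedAddCommGroup E]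
    [TopologicalSpace.SeparableSpace E] {C : ℝ≥0} {f : ℕ → E → ℝ}
    (hf : ∀ n, LipschitzWith C (f n)) (h0 : ∀ n, f n 0 = 0) :
    ∃ (σ : ℕ → ℕ) (g : E → ℝ), StrictMono σ ∧ LipschitzWith C g ∧
      ∀ x, Tendsto (fun n => f (σ n) x) atTop (𝓝 (g x)) := by
  let s := TopologicalSpace.denseSeq E
  have hs : DenseRange s := TopologicalSpace.denseRange_denseSeq E
  have hcpt : IsCompact (Set.pi univ fun k => Icc (-(C * ‖s k‖)) (C * ‖s k‖)) :=
    isCompact_univ_pi fun k => isCompact_Icc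
  have hmem : ∀ n, (fun k => f n (s k)) ∈ Set.pi univ fun k => Icc (-(C * ‖s k‖)) (C * ‖s k‖) := by
    intro n k _
    have := (hf n).dist_le_mul (s k) 0
    rw [h0, dist_zero_right, dist_zero_right, Real.norm_eq_abs] at this
    exact abs_le.1 this
  obtain ⟨l, -, σ, hσ, hl⟩ := hcpt.tendsto_subseq hmem
  have hl' : ∀ k, Tendsto (fun n => f (σ n) (s k)) atTop (𝓝 (l k)) := tendsto_pi_nhds.1 hl
  have hcau : ∀ x, CauchySeq fun n => f (σ n) x := by
    intro x
    refine Metric.cauchySeq_iff'.2 fun ε hε => ?_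
    have hC : (0 : ℝ) < C + 1 := by positivity
    obtain ⟨k, hk⟩ := hs.exists_dist_lt x (show 0 < ε / 4 / (C + 1) by positivity)
    obtain ⟨N, hN⟩ := Metric.cauchySeq_iff'.1 (hl' k).cauchySeq (ε / 4) (by positivity)
    refine ⟨N, fun n hn => ?_⟩
    have key : ∀ m, dist (f m x) (f m (s k)) ≤ ε / 4 := fun m => by
      refine ((hf m).dist_le_mul _ _).trans ?_
      calc (C : ℝ) * dist x (s k) ≤ (C + 1) * (ε / 4 / (C + 1)) := by gcongr; linarith
        _ = ε / 4 := by field_simp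
    have h1 := key (σ n)
    have h2 := key (σ N)
    have h3 := hN n hn
    rw [Real.dist_eq] at *
    rw [abs_le] at h1 h2
    rw [abs_lt] at *
    constructor <;> linarith
  choose g hg using fun x => cauchySeq_tendsto_of_complete (hcau x)
  refine ⟨σ, g, hσ, LipschitzWith.of_dist_le_mul fun x y => ?_, hg⟩
  exact le_of_tendsto ((hg x).dist (hg y)) (Eventually.of_forall fun n => (hf _).dist_le_mul x y)

theorem exists_ae_bound_of_memLp_top {α : Type*} [MeasurableSpace α] {μ : Measure α} {f : α → ℝ}
    (hf : MemLp f ⊤ μ) : ∃ C : ℝ≥0, ∀ᵐ x ∂μ, ‖f x‖ ≤ C := by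
  have h : eLpNormEssSup f μ < ⊤ := by simpa using hf.eLpNorm_lt_top
  refine ⟨(eLpNormEssSup f μ).toNNReal, ?_⟩
  filter_upwards [ae_le_eLpNormEssSup (f := f) (μ := μ)] with x hx
  rw [← ENNReal.coe_toNNReal h.ne, enorm_le_coe] at hx
  exact_mod_cast hx

section Mollification

variable {E : Type*} [NormedAddCommGroup E] [NormedSpace ℝ E] [FiniteDimensional ℝ E]
  [MeasurableSpace E] [BorelSpace E] {μ : Measure E} [μ.IsAddHaarMeasure] {P η : E → ℝ}

theorem fderiv_convolution_apply (hP : LocallyIntegrable P μ) (hη : ContDiff ℝ ∞ η)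
    (hc : HasCompactSupport η) (x v : E) :
    fderiv ℝ (η ⋆[ContinuousLinearMap.lsmul ℝ ℝ, μ] P) x v
      = ∫ q, P q * fderiv ℝ η (x - q) v ∂μ := by
  rw [← convolution_flip, (hc.hasFDerivAt_convolution_right (ContinuousLinearMap.lsmul ℝ ℝ).flip hP
    (hη.of_le (by simp)) x).fderiv, convolution_precompR_apply _ hP (hc.fderiv ℝ)
    (hη.continuous_fderiv (by simp)), convolution_def]
  simp [mul_comm]

theorem norm_convolution_le (hη : ContDiff ℝ ∞ η)
    (hc : HasCompactSupport η) (h0 : ∀ x, 0 ≤ η x) (h1 : ∫ x, η x ∂μ = 1) {C : ℝ≥0}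
    (hC : ∀ᵐ x ∂μ, ‖P x‖ ≤ C) (x : E) :
    ‖(η ⋆[ContinuousLinearMap.lsmul ℝ ℝ, μ] P) x‖ ≤ C := by
  have hi : Integrable η μ := hη.continuous.integrable_of_hasCompactSupport hc
  rw [convolution_def]
  refine (norm_integral_le_of_norm_le (hi.mul_const (C : ℝ)) ?_).trans ?_
  · have := (quasiMeasurePreserving_sub_left μ x).ae hC
    filter_upwards [this] with t ht
    simp only [ContinuousLinearMap.lsmul_apply, smul_eq_mul, norm_mul, Real.norm_of_nonneg (h0 t)]
    exact mul_le_mul_of_nonneg_left ht (h0 t)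
  · rw [integral_mul_const, h1, one_mul]

end Mollification

/-! ### Potentials of divergence-free fields in the plane. -/

/-- The linear form on the plane with coordinates `a`, `b`. -/
noncomputable def planeForm (a b : ℝ) : ℝ × ℝ →L[ℝ] ℝ :=
  a • ContinuousLinearMap.fst ℝ ℝ ℝ + b • ContinuousLinearMap.snd ℝ ℝ ℝ

theorem planeForm_apply (a b : ℝ) (v : ℝ × ℝ) : planeForm a b v = a * v.1 + b * v.2 := by
  simp [planeForm]

theorem clm_eq_planeForm (L : ℝ × ℝ →L[ℝ] ℝ) : L = planeForm (L (1, 0)) (L (0, 1)) := by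
  ext <;> simp [planeForm_apply]

theorem nnnorm_planeForm_le {a b : ℝ} {A B : ℝ≥0} (ha : ‖a‖ ≤ A) (hb : ‖b‖ ≤ B) :
    ‖planeForm a b‖₊ ≤ A + B := by
  refine ContinuousLinearMap.opNNNorm_le_bound _ _ fun v => ?_
  rw [← NNReal.coe_le_coe, planeForm_apply]
  push_cast
  have h1 : ‖v.1‖ ≤ ‖v‖ := norm_fst_le v
  have h2 : ‖v.2‖ ≤ ‖v‖ := norm_snd_le v
  calc ‖a * v.1 + b * v.2‖ ≤ ‖a‖ * ‖v.1‖ + ‖b‖ * ‖v.2‖ := by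
        rw [← norm_mul, ← norm_mul]; exact norm_add_le _ _
    _ ≤ A * ‖v‖ + B * ‖v‖ := by gcongr
    _ = _ := by ring

/-- Smooth closed forms in the plane have potentials. -/
theorem exists_potential_of_contDiff {u v : ℝ × ℝ → ℝ} (hu : ContDiff ℝ 1 u) (hv : ContDiff ℝ 1 v)
    (h : ∀ p, fderiv ℝ u p (0, 1) = fderiv ℝ v p (1, 0)) {A B : ℝ≥0} (hA : ∀ p, ‖u p‖ ≤ A)
    (hB : ∀ p, ‖v p‖ ≤ B) :
    ∃ H : ℝ × ℝ → ℝ, LipschitzWith (A + B) H ∧ H 0 = 0 ∧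
      ∀ p, HasFDerivAt H (planeForm (u p) (v p)) p := by
  have hω : ∀ p, HasFDerivAt (fun p => planeForm (u p) (v p))
      ((fderiv ℝ u p).smulRight (ContinuousLinearMap.fst ℝ ℝ ℝ)
        + (fderiv ℝ v p).smulRight (ContinuousLinearMap.snd ℝ ℝ ℝ)) p := by
    intro p
    have h1 := (hu.differentiable one_ne_zero p).hasFDerivAt.smul_const
      (ContinuousLinearMap.fst ℝ ℝ ℝ)
    have h2 := (hv.differentiable one_ne_zero p).hasFDerivAt.smul_const
      (ContinuousLinearMap.snd ℝ ℝ ℝ)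
    exact h1.add h2
  obtain ⟨H, hH⟩ : ∃ H : ℝ × ℝ → ℝ, ∀ p ∈ univ, HasFDerivAt H (planeForm (u p) (v p)) p :=
    (convex_univ (𝕜 := ℝ) (E := ℝ × ℝ)).exists_forall_hasFDerivAt_of_fderiv_symmetric isOpen_univ
    (fun p _ => (hω p).differentiableAt.differentiableWithinAt) (fun p _ x y => by
      rw [(hω p).fderiv]
      have e1 := clm_eq_planeForm (fderiv ℝ u p)
      have e2 := clm_eq_planeForm (fderiv ℝ v p)
      simp only [_root_.add_apply, ContinuousLinearMap.smulRight_apply,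
        _root_.smul_apply, ContinuousLinearMap.coe_fst', ContinuousLinearMap.coe_snd',
        smul_eq_mul]
      rw [e1, e2]
      simp only [planeForm_apply, h]
      ring)
  have hH' : ∀ p, HasFDerivAt (fun p => H p - H 0) (planeForm (u p) (v p)) p := fun p =>
    (hH p (mem_univ p)).sub_const _
  refine ⟨fun p => H p - H 0, ?_, by simp, hH'⟩
  refine lipschitzWith_of_nnnorm_fderiv_le (𝕜 := ℝ) (fun p => (hH' p).differentiableAt) fun p => ?_
  rw [(hH' p).fderiv]
  exact nnnorm_planeForm_le (hA p) (hB p)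

/-- A bounded weakly divergence-free field in the plane has a Lipschitz stream function. -/
theorem exists_lipschitz_potential {P Q : ℝ × ℝ → ℝ} (hP : MemLp P ⊤ volume)
    (hQ : MemLp Q ⊤ volume)
    (h : ∀ φ, IsTestFunction φ →
      ∫ p, (P p * fderiv ℝ φ p (1, 0) + Q p * fderiv ℝ φ p (0, 1)) = 0) :
    ∃ (H : ℝ × ℝ → ℝ) (C : ℝ≥0), LipschitzWith C H ∧
      ∀ᵐ p, fderiv ℝ H p (0, 1) = P p ∧ fderiv ℝ H p (1, 0) = - Q p := by
  obtain ⟨A, hA⟩ := exists_ae_bound_of_memLp_top hP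
  obtain ⟨B, hB⟩ := exists_ae_bound_of_memLp_top hQ
  have hPl : LocallyIntegrable P volume := hP.locallyIntegrable le_top
  have hQl : LocallyIntegrable Q volume := hQ.locallyIntegrable le_top
  -- The bounded ratio of the outer to the inner radius is what gives almost everywhere convergence
  -- of the mollifications.
  let b : ℕ → ContDiffBump (0 : ℝ × ℝ) := fun n =>
    { rIn := 1 / (n + 1), rOut := 2 * (1 / (n + 1)), rIn_pos := by positivity
      rIn_lt_rOut := by have : (0 : ℝ) < 1 / (n + 1) := by positivity
                        linarith }
  let η : ℕ → ℝ × ℝ → ℝ := fun n => (b n).normed volume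
  have hη : ∀ n, ContDiff ℝ ∞ (η n) := fun n => (b n).contDiff_normed
  have hηc : ∀ n, HasCompactSupport (η n) := fun n => (b n).hasCompactSupport_normed
  have hη0 : ∀ n x, 0 ≤ η n x := fun n x => (b n).nonneg_normed x
  have hη1 : ∀ n, ∫ x, η n x = 1 := fun n => (b n).integral_normed
  have hb : Tendsto (fun n => (b n).rOut) atTop (𝓝 0) := by
    have := (tendsto_one_div_add_atTop_nhds_zero_nat (𝕜 := ℝ)).const_mul 2
    rwa [mul_zero] at this
  have hb' : ∀ᶠ n in atTop, (b n).rOut ≤ 2 * (b n).rIn := Eventually.of_forall fun n => le_rfl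
  let Pn : ℕ → ℝ × ℝ → ℝ := fun n => η n ⋆[ContinuousLinearMap.lsmul ℝ ℝ, volume] P
  let Qn : ℕ → ℝ × ℝ → ℝ := fun n => η n ⋆[ContinuousLinearMap.lsmul ℝ ℝ, volume] Q
  have hPn : ∀ᵐ x, Tendsto (fun n => Pn n x) atTop (𝓝 (P x)) :=
    ContDiffBump.ae_convolution_tendsto_right_of_locallyIntegrable hb hb' hPl
  have hQn : ∀ᵐ x, Tendsto (fun n => Qn n x) atTop (𝓝 (Q x)) :=
    ContDiffBump.ae_convolution_tendsto_right_of_locallyIntegrable hb hb' hQl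
  have hPs : ∀ n, ContDiff ℝ 1 (Pn n) := fun n => by
    exact_mod_cast (hηc n).contDiff_convolution_left (n := 1) (ContinuousLinearMap.lsmul ℝ ℝ)
      ((hη n).of_le (by simp)) hPl
  have hQs : ∀ n, ContDiff ℝ 1 (Qn n) := fun n => by
    exact_mod_cast (hηc n).contDiff_convolution_left (n := 1) (ContinuousLinearMap.lsmul ℝ ℝ)
      ((hη n).of_le (by simp)) hQl
  have hPb : ∀ n x, ‖Pn n x‖ ≤ A := fun n => norm_convolution_le (hη n) (hηc n) (hη0 n) (hη1 n) hA
  have hQb : ∀ n x, ‖Qn n x‖ ≤ B := fun n => norm_convolution_le (hη n) (hηc n) (hη0 n) (hη1 n) hB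
  -- The weak equation tested with `q ↦ η n (x - q)` is the pointwise equation for the mollified
  -- field.
  have hdiv : ∀ n x, fderiv ℝ (fun y => - Qn n y) x (0, 1) = fderiv ℝ (Pn n) x (1, 0) := by
    intro n x
    have hφ : IsTestFunction fun q => η n (x - q) :=
      ⟨(hη n).comp (contDiff_const.sub contDiff_id), (hηc n).comp_homeomorph (Homeomorph.subLeft x)⟩
    have hd : ∀ q v, fderiv ℝ (fun q => η n (x - q)) q v = - fderiv ℝ (η n) (x - q) v := by
      intro q v
      have h1 : HasFDerivAt (fun q : ℝ × ℝ => x - q) (-ContinuousLinearMap.id ℝ (ℝ × ℝ)) q := by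
        simpa using (hasFDerivAt_id q).const_sub x
      have h2 := ((hη n).differentiable (by simp) (x - q)).hasFDerivAt.comp q h1
      have h3 : fderiv ℝ (fun q => η n (x - q)) q = _ := h2.fderiv
      rw [h3]; simp
    have hi : ∀ (R : ℝ × ℝ → ℝ) (v : ℝ × ℝ), LocallyIntegrable R volume →
        Integrable fun q => R q * fderiv ℝ (η n) (x - q) v := by
      intro R v hR
      have hc : Continuous fun q => fderiv ℝ (η n) (x - q) v :=
        (((hη n).continuous_fderiv (by simp)).comp (continuous_const.sub continuous_id)).clm_apply
          continuous_const
      have hs : HasCompactSupport fun q => fderiv ℝ (η n) (x - q) v :=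
        ((hηc n).fderiv_apply ℝ v).comp_homeomorph (Homeomorph.subLeft x)
      simpa [mul_comm] using hR.integrable_smul_left_of_hasCompactSupport hc hs
    have h0 := h _ hφ
    simp only [hd, mul_neg] at h0
    rw [integral_add (f := fun p => -(P p * fderiv ℝ (η n) (x - p) (1, 0)))
      (g := fun p => -(Q p * fderiv ℝ (η n) (x - p) (0, 1))) (hi P _ hPl).neg (hi Q _ hQl).neg,
      integral_neg, integral_neg] at h0
    have e1 : fderiv ℝ (fun y => - Qn n y) x (0, 1) = - fderiv ℝ (Qn n) x (0, 1) := by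
      rw [fderiv_fun_neg]; rfl
    rw [e1, fderiv_convolution_apply hPl (hη n) (hηc n), fderiv_convolution_apply hQl (hη n) (hηc n)]
    linarith
  choose Hn hHL hH0 hHd using fun n => exists_potential_of_contDiff (hQs n).neg (hPs n) (hdiv n)
    (A := B) (fun p => by rw [norm_neg]; exact hQb n p) (hPb n)
  obtain ⟨σ, H, hσ, hHlip, hlim⟩ := exists_subseq_tendsto_of_lipschitzWith hHL hH0
  -- Identifies the derivatives of the limit: against a test function, the integrals of the
  -- derivatives of `Hn` converge in two ways, through convergence of `Hn` after integration by
  -- parts and through convergence of `Rn`.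
  have key : ∀ (v : ℝ × ℝ) (R : ℝ × ℝ → ℝ) (Rn : ℕ → ℝ × ℝ → ℝ) (D : ℝ≥0),
      LocallyIntegrable R volume → (∀ n, Continuous (Rn n)) → (∀ n x, ‖Rn n x‖ ≤ D) →
      (∀ᵐ x, Tendsto (fun n => Rn n x) atTop (𝓝 (R x))) →
      (∀ n x, lineDeriv ℝ (Hn n) x v = Rn n x) → ∀ᵐ x, lineDeriv ℝ H x v = R x := by
    intro v R Rn D hR hRc hRb hRt hRe
    refine ae_eq_of_integral_contDiff_smul_eq (hHlip.locallyIntegrable_lineDeriv v) hR ?_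
    intro φ hφ hφc
    obtain ⟨K, hK⟩ := ContDiff.lipschitzWith_of_hasCompactSupport hφc hφ (by simp)
    have ibp : ∀ {f : ℝ × ℝ → ℝ} {D : ℝ≥0}, LipschitzWith D f →
        ∫ x, φ x • lineDeriv ℝ f x v = ∫ x, lineDeriv ℝ φ x (-v) * f x := fun hf => by
      rw [← hf.integral_lineDeriv_mul_eq hK hφc v]
      simp [mul_comm]
    have hφi : Integrable φ volume := hφ.continuous.integrable_of_hasCompactSupport hφc
    have hld : (fun x => lineDeriv ℝ φ x (-v)) = fun x => fderiv ℝ φ x (-v) := by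
      ext x; exact (hφ.differentiable (by simp) x).lineDeriv_eq_fderiv
    have hcont : Continuous fun x => lineDeriv ℝ φ x (-v) := by
      rw [hld]; exact (hφ.continuous_fderiv (by simp)).clm_apply continuous_const
    have L1 : Tendsto (fun n => ∫ x, φ x • lineDeriv ℝ (Hn (σ n)) x v) atTop
        (𝓝 (∫ x, φ x • lineDeriv ℝ H x v)) := by
      rw [ibp hHlip]
      simp_rw [fun n => ibp (hHL (σ n))]
      refine tendsto_integral_of_dominated_convergence
        (fun x => ‖lineDeriv ℝ φ x (-v)‖ * ((B + A : ℝ≥0) * ‖x‖)) ?_ ?_ ?_ ?_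
      · exact fun n => (hcont.mul (hHL _).continuous).aestronglyMeasurable
      · exact (hcont.norm.mul (continuous_const.mul continuous_norm)).integrable_of_hasCompactSupport
          ((hφc.lineDeriv (-v)).norm.mul_right)
      · refine fun n => Eventually.of_forall fun x => ?_
        rw [norm_mul]
        have := (hHL (σ n)).dist_le_mul x 0
        rw [hH0, dist_zero_right, dist_zero_right] at this
        gcongr
      · exact Eventually.of_forall fun x => (hlim x).const_mul _
    have L2 : Tendsto (fun n => ∫ x, φ x • lineDeriv ℝ (Hn (σ n)) x v) atTop
        (𝓝 (∫ x, φ x • R x)) := by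
      simp_rw [hRe]
      refine tendsto_integral_of_dominated_convergence (fun x => ‖φ x‖ * D) ?_ (hφi.norm.mul_const _)
        ?_ ?_
      · exact fun n => (hφ.continuous.smul (hRc _)).aestronglyMeasurable
      · refine fun n => Eventually.of_forall fun x => ?_
        rw [norm_smul]
        exact mul_le_mul_of_nonneg_left (hRb _ x) (norm_nonneg _)
      · exact hRt.mono fun x hx => (hx.comp hσ.tendsto_atTop).const_smul _
    exact tendsto_nhds_unique L1 L2
  have h1 := key (0, 1) P Pn A hPl (fun n => (hPs n).continuous) hPb hPn (fun n x => by
    rw [(hHd n x).differentiableAt.lineDeriv_eq_fderiv, (hHd n x).fderiv, planeForm_apply]; simp)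
  have h2 := key (1, 0) (fun x => - Q x) (fun n x => - Qn n x) B hQl.neg
    (fun n => (hQs n).continuous.neg) (fun n x => by rw [norm_neg]; exact hQb n x)
    (hQn.mono fun x hx => hx.neg) (fun n x => by
    rw [(hHd n x).differentiableAt.lineDeriv_eq_fderiv, (hHd n x).fderiv, planeForm_apply]; simp)
  refine ⟨H, B + A, hHlip, ?_⟩
  filter_upwards [h1, h2, hHlip.ae_differentiableAt] with p hp1 hp2 hd
  rw [← hd.lineDeriv_eq_fderiv, ← hd.lineDeriv_eq_fderiv]
  exact ⟨hp1, hp2⟩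

/-! ### Fields on the half-plane: stream functions up to the boundary and Green's formula. -/

theorem measurableSet_halfPlane : MeasurableSet halfPlane := measurableSet_Ici.prod .univ

theorem ae_fst_ne_zero : ∀ᵐ p : ℝ × ℝ, p.1 ≠ 0 :=
  Measure.quasiMeasurePreserving_fst.ae (Measure.ae_ne volume 0)

theorem ae_restrict_halfPlane_iff {p : ℝ × ℝ → Prop} :
    (∀ᵐ x ∂(volume.restrict halfPlane), p x) ↔ ∀ᵐ x : ℝ × ℝ, 0 < x.1 → p x := by
  rw [ae_restrict_iff' measurableSet_halfPlane]
  constructor <;> intro h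
  · filter_upwards [h] with x hx h0 using hx ⟨h0.le, mem_univ _⟩
  · filter_upwards [h, ae_fst_ne_zero] with x hx h0 h1 using hx (lt_of_le_of_ne h1.1 h0.symm)

theorem integrable_fderiv_apply {φ : ℝ × ℝ → ℝ} (hφ : IsTestFunction φ) (v : ℝ × ℝ) :
    Integrable (fun p => fderiv ℝ φ p v) volume :=
  ((hφ.1.continuous_fderiv (by simp)).clm_apply continuous_const).integrable_of_hasCompactSupport
    (hφ.2.fderiv_apply ℝ v)

theorem IsTestFunction.lipschitz {φ : ℝ × ℝ → ℝ} (hφ : IsTestFunction φ) :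
    ∃ C, LipschitzWith C φ :=
  ContDiff.lipschitzWith_of_hasCompactSupport hφ.2 hφ.1 (by simp)

theorem MeasureTheory.MemLp.integrable_mul_of_top {α : Type*} [MeasurableSpace α] {μ : Measure α}
    {f g : α → ℝ} (hf : MemLp f ⊤ μ) (hg : Integrable g μ) :
    Integrable (fun x => f x * g x) μ := by
  obtain ⟨C, hC⟩ := exists_ae_bound_of_memLp_top hf
  exact hg.bdd_mul hf.1 hC

theorem MeasureTheory.MemLp.fun_mul_top {α : Type*} [MeasurableSpace α] {μ : Measure α}
    {f g : α → ℝ} (hf : MemLp f ⊤ μ) (hg : MemLp g ⊤ μ) : MemLp (fun x => f x * g x) ⊤ μ := by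
  obtain ⟨C, hC⟩ := exists_ae_bound_of_memLp_top hf
  obtain ⟨D, hD⟩ := exists_ae_bound_of_memLp_top hg
  refine memLp_top_of_bound (hf.1.mul hg.1) (C * D) ?_
  filter_upwards [hC, hD] with x h1 h2
  rw [norm_mul]; gcongr

theorem LipschitzWith.memLp_fderiv_apply {C : ℝ≥0} {f : ℝ × ℝ → ℝ} (hf : LipschitzWith C f)
    (v : ℝ × ℝ) : MemLp (fun p => fderiv ℝ f p v) ⊤ volume :=
  (memLp_congr_ae (hf.ae_differentiableAt.mono fun _ hp => hp.lineDeriv_eq_fderiv)).1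
    (hf.memLp_lineDeriv v)

/-- Merely Lipschitz `g` is allowed so that the test function may later involve a second stream
function. -/
theorem LipschitzWith.integral_curl_eq_zero {C D : ℝ≥0} {f g : ℝ × ℝ → ℝ}
    (hf : LipschitzWith C f) (hg : LipschitzWith D g) (hc : HasCompactSupport g) :
    ∫ p, (fderiv ℝ f p (0, 1) * fderiv ℝ g p (1, 0)
      - fderiv ℝ f p (1, 0) * fderiv ℝ g p (0, 1)) = 0 := by
  have e : ∀ᵐ p, fderiv ℝ f p (0, 1) * fderiv ℝ g p (1, 0)
      - fderiv ℝ f p (1, 0) * fderiv ℝ g p (0, 1)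
      = lineDeriv ℝ f p (0, 1) * lineDeriv ℝ g p (1, 0)
      - lineDeriv ℝ f p (1, 0) * lineDeriv ℝ g p (0, 1) := by
    filter_upwards [hf.ae_differentiableAt, hg.ae_differentiableAt] with p h1 h2
    simp only [h1.lineDeriv_eq_fderiv, h2.lineDeriv_eq_fderiv]
  have i : ∀ v w, Integrable (fun p => lineDeriv ℝ f p v * lineDeriv ℝ g p w) volume :=
    fun v w => (hf.memLp_lineDeriv v).integrable_mul_of_top (hg.integrable_lineDeriv hc w)
  rw [integral_congr_ae e, integral_sub (i _ _) (i _ _),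
    hf.integral_lineDeriv_mul_lineDeriv_comm hg hc, sub_self]

theorem deriv_smoothTransition_eq_zero {s : ℝ} (h1 : 1 < s) :
    deriv Real.smoothTransition s = 0 := by
  have : Real.smoothTransition =ᶠ[𝓝 s] fun _ => 1 := by
    filter_upwards [lt_mem_nhds h1] with y hy using Real.smoothTransition.one_of_one_le hy.le
  rw [this.deriv_eq]; simp

theorem exists_bound_deriv_smoothTransition : ∃ D : ℝ, ∀ s, ‖deriv Real.smoothTransition s‖ ≤ D := by
  have hc : HasCompactSupport (deriv Real.smoothTransition) := by
    refine HasCompactSupport.intro (isCompact_Icc (a := (0 : ℝ)) (b := 1)) fun x hx => ?_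
    rcases lt_or_ge x 0 with h | h
    · have : Real.smoothTransition =ᶠ[𝓝 x] fun _ => 0 := by
        filter_upwards [gt_mem_nhds h] with y hy using Real.smoothTransition.zero_of_nonpos hy.le
      rw [this.deriv_eq]; simp
    · have h1 : 1 < x := by by_contra h'; exact hx ⟨h, not_lt.1 h'⟩
      exact deriv_smoothTransition_eq_zero h1
  exact hc.exists_bound_of_continuous
    ((Real.smoothTransition.contDiff (n := 1)).continuous_deriv le_rfl)

/-- Test functions which merely vanish on the boundary of the half-plane may be used for
divergence-free fields in the open half-plane. -/
theorem divPairing_eq_zero_of_boundary {g G : ℝ × ℝ → ℝ} (hg : IsBoundedField g)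
    (hG : IsBoundedField G)
    (h : ∀ φ, IsTestFunction φ → tsupport φ ⊆ Ioi 0 ×ˢ univ → divPairing g G φ = 0)
    {ψ : ℝ × ℝ → ℝ} (hψ : IsTestFunction ψ) (hψ0 : ∀ x, ψ (0, x) = 0) :
    divPairing g G ψ = 0 := by
  obtain ⟨A, hA⟩ := exists_ae_bound_of_memLp_top hg
  obtain ⟨B, hB⟩ := exists_ae_bound_of_memLp_top hG
  obtain ⟨L, hL⟩ := hψ.lipschitz
  obtain ⟨D, hD⟩ := exists_bound_deriv_smoothTransition
  let S := Real.smoothTransition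
  -- `S (a n p)` vanishes for times up to `1/(n+1)` and equals 1 from `2/(n+1)` on. Its derivative
  -- is of order `n`, but `ψ` is at most `L` times the time, so their product is bounded by `2 * D *
  -- L` on the transition layer, uniformly in `n`.
  let a : ℕ → ℝ × ℝ → ℝ := fun n p => (n + 1) * p.1 - 1
  let φ : ℕ → ℝ × ℝ → ℝ := fun n p => S (a n p) * ψ p
  have ha : ∀ n p, HasFDerivAt (a n) (((n : ℝ) + 1) • ContinuousLinearMap.fst ℝ ℝ ℝ) p := fun n p =>
    (hasFDerivAt_fst.const_mul _).sub_const _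
  have hφd : ∀ n p v, fderiv ℝ (φ n) p v
      = S (a n p) * fderiv ℝ ψ p v + deriv S (a n p) * ((n + 1) * v.1) * ψ p := by
    intro n p v
    have h1 : HasFDerivAt (fun p => S (a n p))
        (deriv S (a n p) • (((n : ℝ) + 1) • ContinuousLinearMap.fst ℝ ℝ ℝ)) p :=
      (((Real.smoothTransition.contDiff (n := 1)).differentiable one_ne_zero
        (a n p)).hasDerivAt).comp_hasFDerivAt p (ha n p)
    have h2 := h1.mul (hψ.1.differentiable (by simp) p).hasFDerivAt
    have h3 : fderiv ℝ (φ n) p = _ := h2.fderiv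
    rw [h3]; simp; ring
  have hφt : ∀ n, IsTestFunction (φ n) := fun n =>
    ⟨(Real.smoothTransition.contDiff.comp
      ((contDiff_const.mul contDiff_fst).sub contDiff_const)).mul hψ.1, hψ.2.mul_left⟩
  have hφs : ∀ n, tsupport (φ n) ⊆ Ioi 0 ×ˢ univ := by
    intro n p hp
    have hcl : IsClosed {p : ℝ × ℝ | 0 ≤ a n p} := isClosed_le continuous_const
      ((continuous_const.mul continuous_fst).sub continuous_const)
    have : p ∈ {p : ℝ × ℝ | 0 ≤ a n p} := by
      refine closure_minimal ?_ hcl hp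
      intro q hq
      by_contra h'
      exact hq (by simp [φ, S, Real.smoothTransition.zero_of_nonpos (not_le.1 h').le])
    have h1 : 0 ≤ (n + 1) * p.1 - 1 := this
    refine ⟨?_, mem_univ _⟩
    by_contra h'
    have : p.1 ≤ 0 := not_lt.1 h'
    nlinarith [(Nat.cast_nonneg n : (0 : ℝ) ≤ n)]
  have key : Tendsto (fun n => divPairing g G (φ n)) atTop (𝓝 (divPairing g G ψ)) := by
    unfold divPairing
    refine tendsto_integral_of_dominated_convergence
      (fun p => A * (‖fderiv ℝ ψ p (1, 0)‖ + (tsupport ψ).indicator (fun _ => 2 * D * L) p)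
        + B * ‖fderiv ℝ ψ p (0, 1)‖) ?_ ?_ ?_ ?_
    · exact fun n => (hg.1.mul (integrable_fderiv_apply (hφt n) _).1.restrict).add
        (hG.1.mul (integrable_fderiv_apply (hφt n) _).1.restrict)
    · have i1 := (integrable_fderiv_apply hψ (1, 0)).norm
      have i2 := (integrable_fderiv_apply hψ (0, 1)).norm
      have i3 : Integrable ((tsupport ψ).indicator (fun _ => 2 * D * L)) (volume : Measure (ℝ × ℝ)) :=
        (integrable_indicator_iff (isClosed_tsupport ψ).measurableSet).2
          (integrableOn_const hψ.2.measure_lt_top.ne)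
      exact (((i1.add i3).const_mul _).add (i2.const_mul _)).restrict
    · intro n
      filter_upwards [hA, hB, ae_restrict_mem measurableSet_halfPlane] with p hpA hpB hp
      have hp1 : 0 ≤ p.1 := hp.1
      have hS : ‖S (a n p)‖ ≤ 1 := by
        rw [Real.norm_of_nonneg (Real.smoothTransition.nonneg _)]
        exact Real.smoothTransition.le_one _
      have hD0 : 0 ≤ D := (norm_nonneg _).trans (hD 0)
      have hb : ‖deriv S (a n p) * ((n + 1) * 1) * ψ p‖
          ≤ (tsupport ψ).indicator (fun _ => 2 * D * L) p := by
        by_cases hps : p ∈ tsupport ψ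
        · rw [indicator_of_mem hps]
          rcases lt_or_ge 1 (a n p) with h1 | h1
          · have : deriv S (a n p) = 0 := deriv_smoothTransition_eq_zero h1
            rw [this]; simp; positivity
          · have h1' : (n + 1) * p.1 ≤ 2 := by
              have : (n + 1) * p.1 - 1 ≤ 1 := h1
              linarith
            have h2 : ‖ψ p‖ ≤ L * p.1 := by
              have := hL.dist_le_mul p (0, p.2)
              rw [hψ0, dist_zero_right] at this
              refine this.trans (le_of_eq ?_)
              simp [Prod.dist_eq, abs_of_nonneg hp1, hp1]
            have hn : (0 : ℝ) ≤ n + 1 := by positivity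
            calc ‖deriv S (a n p) * ((n + 1) * 1) * ψ p‖
                = ‖deriv S (a n p)‖ * (n + 1) * ‖ψ p‖ := by
                  rw [norm_mul, norm_mul, mul_one, Real.norm_of_nonneg hn]
              _ ≤ D * (n + 1) * (L * p.1) := by
                  gcongr
                  exact hD _
              _ = D * L * ((n + 1) * p.1) := by ring
              _ ≤ D * L * 2 := by gcongr
              _ = 2 * D * L := by ring
        · rw [indicator_of_notMem hps, image_eq_zero_of_notMem_tsupport hps]; simp
      rw [hφd, hφd]
      simp only [mul_zero, zero_mul, add_zero]
      refine (norm_add_le _ _).trans ?_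
      rw [norm_mul, norm_mul]
      gcongr
      · refine (norm_add_le _ _).trans ?_
        gcongr
        rw [norm_mul]
        exact mul_le_of_le_one_left (norm_nonneg _) hS
      · rw [norm_mul]
        exact mul_le_of_le_one_left (norm_nonneg _) hS
    · rw [ae_restrict_halfPlane_iff]
      refine Eventually.of_forall fun p hp => ?_
      refine tendsto_const_nhds.congr' ?_
      obtain ⟨N, hN⟩ := exists_nat_gt (2 / p.1)
      filter_upwards [eventually_ge_atTop N] with n hn
      have h1 : 1 < a n p := by
        have : (N : ℝ) ≤ n := by exact_mod_cast hn
        have h2 : 2 < (n + 1) * p.1 := by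
          rw [div_lt_iff₀ hp] at hN
          nlinarith
        show 1 < (n + 1) * p.1 - 1
        linarith
      have h2 : deriv S (a n p) = 0 := deriv_smoothTransition_eq_zero h1
      have h3 : S (a n p) = 1 := Real.smoothTransition.one_of_one_le h1.le
      rw [hφd, hφd, h2, h3]
      simp
  refine tendsto_nhds_unique key ?_
  simp_rw [fun n => h _ (hφt n) (hφs n)]
  exact tendsto_const_nhds

/-- A bounded divergence-free field in the open half-plane has a stream function which is Lipschitz
up to the boundary; it is extended to negative times by its boundary values. -/
theorem exists_lipschitz_potential_halfPlane {g G : ℝ × ℝ → ℝ} (hg : IsBoundedField g)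
    (hG : IsBoundedField G)
    (h : ∀ φ, IsTestFunction φ → tsupport φ ⊆ Ioi 0 ×ˢ univ → divPairing g G φ = 0) :
    ∃ (H : ℝ × ℝ → ℝ) (C : ℝ≥0), LipschitzWith C H ∧ (∀ t ≤ 0, ∀ x, H (t, x) = H (0, x)) ∧
      ∀ᵐ p : ℝ × ℝ, 0 < p.1 → fderiv ℝ H p (0, 1) = g p ∧ fderiv ℝ H p (1, 0) = - G p := by
  -- Reflection in time, with density extended evenly and flux oddly. Pairing the extended field
  -- with `φ` is pairing the original with `φ - φ ∘ σ`, which vanishes at time 0, so no divergence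
  -- is created on the boundary line.
  let σ : ℝ × ℝ → ℝ × ℝ := fun p => (-p.1, p.2)
  have hσ : MeasurePreserving σ volume volume :=
    (Measure.measurePreserving_neg (volume : Measure ℝ)).prod (MeasurePreserving.id volume)
  have hσσ : ∀ p, σ (σ p) = p := fun p => by simp [σ]
  have hσs : ContDiff ℝ ∞ σ := contDiff_fst.neg.prodMk contDiff_snd
  let σh : ℝ × ℝ ≃ₜ ℝ × ℝ := ⟨⟨σ, σ, hσσ, hσσ⟩, hσs.continuous, hσs.continuous⟩
  let P := halfPlane.indicator g
  let Q := halfPlane.indicator G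
  have hP : MemLp P ⊤ volume := (memLp_indicator_iff_restrict measurableSet_halfPlane).2 hg
  have hQ : MemLp Q ⊤ volume := (memLp_indicator_iff_restrict measurableSet_halfPlane).2 hG
  have hPσ : MemLp (fun p => P (σ p)) ⊤ volume := hP.comp_measurePreserving hσ
  have hQσ : MemLp (fun p => Q (σ p)) ⊤ volume := hQ.comp_measurePreserving hσ
  obtain ⟨H, C, hH, hHd⟩ := exists_lipschitz_potential (P := fun p => P p + P (σ p))
    (Q := fun p => Q p - Q (σ p)) (hP.add hPσ) (hQ.sub hQσ) (by
      intro φ hφ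
      have hψ : IsTestFunction fun p => φ p - φ (σ p) :=
        ⟨hφ.1.sub (hφ.1.comp hσs), hφ.2.sub (hφ.2.comp_homeomorph σh)⟩
      have hψd : ∀ p v, fderiv ℝ (fun p => φ p - φ (σ p)) p v
          = fderiv ℝ φ p v - fderiv ℝ φ (σ p) (-v.1, v.2) := by
        intro p v
        have h1 : HasFDerivAt σ ((-ContinuousLinearMap.fst ℝ ℝ ℝ).prod
            (ContinuousLinearMap.snd ℝ ℝ ℝ)) p := hasFDerivAt_fst.neg.prodMk hasFDerivAt_snd
        have h2 := (hφ.1.differentiable (by simp) (σ p)).hasFDerivAt.comp p h1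
        have h3 := ((hφ.1.differentiable (by simp) p).hasFDerivAt.sub h2).fderiv
        have h4 : fderiv ℝ (fun p => φ p - φ (σ p)) p = _ := h3
        rw [h4]; simp
      have h0 := divPairing_eq_zero_of_boundary hg hG h hψ (fun x => by simp [σ])
      have hneg : ∀ p, fderiv ℝ φ p (-1, 0) = - fderiv ℝ φ p (1, 0) := fun p => by
        rw [← map_neg]; simp
      unfold divPairing at h0
      rw [← integral_indicator measurableSet_halfPlane] at h0
      have h1 : halfPlane.indicator (fun p => g p * fderiv ℝ (fun p => φ p - φ (σ p)) p (1, 0)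
            + G p * fderiv ℝ (fun p => φ p - φ (σ p)) p (0, 1))
          = fun p => (P p * fderiv ℝ φ p (1, 0) + Q p * fderiv ℝ φ p (0, 1))
            + (P p * fderiv ℝ φ (σ p) (1, 0) - Q p * fderiv ℝ φ (σ p) (0, 1)) := by
        ext p
        by_cases hp : p ∈ halfPlane
        · simp only [P, Q, indicator_of_mem hp, hψd, neg_zero, hneg]; ring
        · simp only [P, Q, indicator_of_notMem hp]; ring
      have i1 := fun v => integrable_fderiv_apply hφ v
      have i2 : ∀ v, Integrable (fun p => fderiv ℝ φ (σ p) v) volume := fun v =>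
        hσ.integrable_comp_of_integrable (i1 v)
      have j1 : Integrable (fun p => P p * fderiv ℝ φ p (1, 0) + Q p * fderiv ℝ φ p (0, 1)) volume :=
        (hP.integrable_mul_of_top (i1 _)).add (hQ.integrable_mul_of_top (i1 _))
      have j2 : Integrable (fun p => P p * fderiv ℝ φ (σ p) (1, 0)
          - Q p * fderiv ℝ φ (σ p) (0, 1)) volume :=
        (hP.integrable_mul_of_top (i2 _)).sub (hQ.integrable_mul_of_top (i2 _))
      have j3 : Integrable (fun p => P (σ p) * fderiv ℝ φ p (1, 0)
          - Q (σ p) * fderiv ℝ φ p (0, 1)) volume :=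
        (hPσ.integrable_mul_of_top (i1 _)).sub (hQσ.integrable_mul_of_top (i1 _))
      rw [h1, integral_add j1 j2, ← hσ.integral_comp σh.measurableEmbedding
        fun p => P p * fderiv ℝ φ (σ p) (1, 0) - Q p * fderiv ℝ φ (σ p) (0, 1)] at h0
      simp only [hσσ] at h0
      rw [← integral_add j1 j3] at h0
      refine (integral_congr_ae (Eventually.of_forall fun p => ?_)).trans h0
      ring)
  -- Clamping time at 0 freezes the boundary values for negative times and changes nothing at
  -- positive times.
  let m : ℝ × ℝ → ℝ × ℝ := fun p => (max p.1 0, p.2)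
  have hm : LipschitzWith 1 m := by
    refine LipschitzWith.of_dist_le_mul fun p q => ?_
    simp only [m, Prod.dist_eq, Real.dist_eq, NNReal.coe_one, one_mul]
    exact max_le_max (abs_max_sub_max_le_abs _ _ _) le_rfl
  refine ⟨fun p => H (m p), C * 1, hH.comp hm, fun t ht x => by simp [m, ht], ?_⟩
  filter_upwards [hHd] with p hp h0
  have e : (fun p => H (m p)) =ᶠ[𝓝 p] H := by
    filter_upwards [(isOpen_lt continuous_const continuous_fst).mem_nhds h0] with q hq
    have : 0 < q.1 := hq
    simp [m, this.le]
  have hpm : p ∈ halfPlane := ⟨h0.le, mem_univ _⟩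
  have hpσ : σ p ∉ halfPlane := fun h' => by
    have : 0 ≤ -p.1 := h'.1
    linarith
  rw [e.fderiv_eq, hp.1, hp.2]
  simp [P, Q, indicator_of_mem hpm, indicator_of_notMem hpσ]

/-- Green's formula for a field which at negative times is vertical and time-independent. -/
theorem integral_eq_divPairing_add {P Q : ℝ × ℝ → ℝ} {r : ℝ → ℝ} (hP : MemLp P ⊤ volume)
    (hQ : MemLp Q ⊤ volume) (h : ∀ᵐ p : ℝ × ℝ, p.1 < 0 → P p = r p.2 ∧ Q p = 0)
    {φ : ℝ × ℝ → ℝ} (hφ : IsTestFunction φ) :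
    ∫ p, (P p * fderiv ℝ φ p (1, 0) + Q p * fderiv ℝ φ p (0, 1))
      = divPairing P Q φ + ∫ x, r x * φ (0, x) := by
  have i : Integrable (fun p => P p * fderiv ℝ φ p (1, 0) + Q p * fderiv ℝ φ p (0, 1)) volume :=
    (hP.integrable_mul_of_top (integrable_fderiv_apply hφ _)).add
      (hQ.integrable_mul_of_top (integrable_fderiv_apply hφ _))
  rw [← integral_add_compl measurableSet_halfPlane i]
  unfold divPairing
  congr 1
  have hc : halfPlaneᶜ = Iio (0 : ℝ) ×ˢ (univ : Set ℝ) := by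
    ext p; simp [halfPlane, mem_prod]
  have e1 : ∀ᵐ p ∂(volume.restrict halfPlaneᶜ), P p * fderiv ℝ φ p (1, 0) + Q p * fderiv ℝ φ p (0, 1)
      = r p.2 * fderiv ℝ φ p (1, 0) := by
    rw [ae_restrict_iff' measurableSet_halfPlane.compl]
    filter_upwards [h] with p hp hp'
    rw [hc] at hp'
    obtain ⟨h1, h2⟩ := hp hp'.1
    rw [h1, h2]; ring
  have i' := (integrable_congr e1).1 i.integrableOn
  rw [integral_congr_ae e1]
  rw [hc] at i' ⊢
  rw [Measure.volume_eq_prod, ← Measure.prod_restrict, Measure.restrict_univ] at i' ⊢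
  rw [integral_prod_symm _ i']
  congr 1; ext x
  refine (integral_const_mul (r x) _).trans ?_
  congr 1
  have hφx : ContDiff ℝ 1 fun t => φ (t, x) :=
    (hφ.1.of_le (by simp)).comp (contDiff_id.prodMk contDiff_const)
  have hφc : HasCompactSupport fun t => φ (t, x) :=
    hφ.2.comp_isClosedEmbedding (Isometry.of_dist_eq (f := fun t : ℝ => (t, x)) fun s t => by
      simp [Prod.dist_eq]).isClosedEmbedding
  rw [← hφc.integral_Iic_deriv_eq hφx 0, integral_Iic_eq_integral_Iio]
  congr 1; ext t
  have h1 : HasDerivAt (fun t : ℝ => (t, x)) ((1 : ℝ), (0 : ℝ)) t :=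
    (hasDerivAt_id t).prodMk (hasDerivAt_const t x)
  exact ((hφ.1.differentiable (by simp) (t, x)).hasFDerivAt.comp_hasDerivAt t h1).deriv.symm

/-! ### Stream functions: trace, directional monotonicity, renormalization. -/

/-- `H` is a Lipschitz function on the plane with `∂_x H = ρ`, `∂_t H = -ρV` at positive times, which
does not depend on time at negative times. -/
structure IsStreamFunction (g G H : ℝ × ℝ → ℝ) : Prop where
  lipschitz : ∃ C, LipschitzWith C H
  initial : ∀ t ≤ 0, ∀ x, H (t, x) = H (0, x)
  deriv_eq : ∀ᵐ p : ℝ × ℝ, 0 < p.1 → fderiv ℝ H p (0, 1) = g p ∧ fderiv ℝ H p (1, 0) = - G p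

namespace IsStreamFunction

variable {g G H : ℝ × ℝ → ℝ}

theorem continuous (h : IsStreamFunction g G H) : Continuous H :=
  let ⟨_, hC⟩ := h.lipschitz
  hC.continuous

theorem ae_differentiableAt (h : IsStreamFunction g G H) : ∀ᵐ p, DifferentiableAt ℝ H p :=
  let ⟨_, hC⟩ := h.lipschitz
  hC.ae_differentiableAt

/-- At negative times the field is vertical and stationary, so integrating it over that half
produces exactly the initial term in Green's formula. -/
theorem deriv_eq_of_neg (h : IsStreamFunction g G H) : ∀ᵐ p : ℝ × ℝ, p.1 < 0 →
    fderiv ℝ H p (0, 1) = deriv (fun x => H (0, x)) p.2 ∧ fderiv ℝ H p (1, 0) = 0 := by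
  filter_upwards [h.ae_differentiableAt] with p hd hp
  constructor
  · have h1 : HasDerivAt (fun x : ℝ => (p.1, x)) ((0 : ℝ), (1 : ℝ)) p.2 :=
      (hasDerivAt_const _ _).prodMk (hasDerivAt_id _)
    have h2 : HasDerivAt (fun x => H (p.1, x)) (fderiv ℝ H p (0, 1)) p.2 :=
      HasFDerivAt.comp_hasDerivAt p.2 hd.hasFDerivAt h1
    simp only [h.initial p.1 hp.le] at h2
    exact h2.deriv.symm
  · have h1 : HasDerivAt (fun t : ℝ => (t, p.2)) ((1 : ℝ), (0 : ℝ)) p.1 :=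
      (hasDerivAt_id _).prodMk (hasDerivAt_const _ _)
    have h2 : HasDerivAt (fun t => H (t, p.2)) (fderiv ℝ H p (1, 0)) p.1 :=
      HasFDerivAt.comp_hasDerivAt p.1 hd.hasFDerivAt h1
    have h3 : (fun t => H (t, p.2)) =ᶠ[𝓝 p.1] fun _ => H (0, p.2) := by
      filter_upwards [gt_mem_nhds hp] with t ht using h.initial t ht.le _
    rw [← h2.deriv, h3.deriv_eq, deriv_const]

theorem memLp_trace (h : IsStreamFunction g G H) : MemLp (deriv fun x => H (0, x)) ⊤ volume := by
  obtain ⟨C, hC⟩ := h.lipschitz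
  have h1 : LipschitzWith (C * 1) fun x => H (0, x) := hC.comp (LipschitzWith.prodMk_left 0)
  exact memLp_top_of_bound (measurable_deriv _).aestronglyMeasurable ((C * 1 : ℝ≥0) : ℝ)
    (Eventually.of_forall fun x => norm_deriv_le_of_lipschitz h1)

/-- The quantity assumed nonnegative is the derivative of `H` along `v`. Monotonicity on the open
half-plane passes to its closure by continuity. -/
theorem le_add (h : IsStreamFunction g G H) {v : ℝ × ℝ} (hv : 0 ≤ v.1)
    (hd : ∀ᵐ p : ℝ × ℝ, 0 < p.1 → 0 ≤ - G p * v.1 + g p * v.2) {p : ℝ × ℝ} (hp : 0 ≤ p.1) :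
    H p ≤ H (p + v) := by
  obtain ⟨C, hC⟩ := h.lipschitz
  have hU : IsOpen (Ioi (0 : ℝ) ×ˢ (univ : Set ℝ)) := isOpen_Ioi.prod isOpen_univ
  have hconv : Convex ℝ (Ioi (0 : ℝ) ×ˢ (univ : Set ℝ)) := (convex_Ioi 0).prod convex_univ
  have hcl : IsClosed {q : ℝ × ℝ | H q ≤ H (q + v)} :=
    isClosed_le h.continuous (h.continuous.comp (continuous_id.add continuous_const))
  have hsub : Ioi (0 : ℝ) ×ˢ (univ : Set ℝ) ⊆ {q : ℝ × ℝ | H q ≤ H (q + v)} := by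
    intro q hq
    refine hC.le_of_ae_lineDeriv_nonneg (μ := volume) hU hconv ?_ hq
      ⟨lt_of_lt_of_le hq.1 (le_add_of_nonneg_right hv), mem_univ _⟩
    filter_upwards [h.deriv_eq, hd, h.ae_differentiableAt] with z hz hz' hzd hzU
    rw [hzd.lineDeriv_eq_fderiv, clm_eq_planeForm (fderiv ℝ H z), planeForm_apply, (hz hzU.1).1,
      (hz hzU.1).2]
    exact hz' hzU.1
  have hp' : p ∈ closure (Ioi (0 : ℝ) ×ˢ (univ : Set ℝ)) := by
    rw [closure_prod_eq, closure_Ioi, closure_univ]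
    exact ⟨hp, mem_univ _⟩
  exact closure_minimal hsub hcl hp'

/-- With `F` an antiderivative of `f`, the chain rule gives `f(H)∇H = ∇(F ∘ H)`, and the curl of a
gradient vanishes weakly. -/
theorem integral_eq_zero_of_continuous (h : IsStreamFunction g G H) {f : ℝ → ℝ} (hf : Continuous f)
    {B : ℝ≥0} (hB : ∀ u, ‖f u‖ ≤ B) {φ : ℝ × ℝ → ℝ} (hφ : IsTestFunction φ) :
    ∫ p, (f (H p) * fderiv ℝ H p (0, 1) * fderiv ℝ φ p (1, 0)
      + -(f (H p) * fderiv ℝ H p (1, 0)) * fderiv ℝ φ p (0, 1)) = 0 := by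
  obtain ⟨C, hC⟩ := h.lipschitz
  obtain ⟨D, hD⟩ := hφ.lipschitz
  let F : ℝ → ℝ := fun u => ∫ s in (0 : ℝ)..u, f s
  have hF : ∀ u, HasDerivAt F (f u) u := fun u =>
    intervalIntegral.integral_hasDerivAt_right (hf.intervalIntegrable _ _)
      (hf.stronglyMeasurableAtFilter _ _) hf.continuousAt
  have hFL : LipschitzWith B F := lipschitzWith_of_nnnorm_deriv_le (fun u => (hF u).differentiableAt)
    fun u => by rw [(hF u).deriv, ← NNReal.coe_le_coe]; exact hB u
  refine (integral_congr_ae ?_).trans ((hFL.comp hC).integral_curl_eq_zero hD hφ.2)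
  filter_upwards [h.ae_differentiableAt] with p hp
  have : fderiv ℝ (F ∘ H) p = f (H p) • fderiv ℝ H p :=
    ((hF (H p)).comp_hasFDerivAt p hp.hasFDerivAt).fderiv
  rw [this]
  simp only [_root_.smul_apply, smul_eq_mul]
  ring

/-- Renormalization: functions of the stream function are transported. -/
theorem integral_eq_zero_of_tendsto (h : IsStreamFunction g G H) {fn : ℕ → ℝ → ℝ} {f : ℝ → ℝ}
    (hfn : ∀ n, Continuous (fn n)) {B : ℝ≥0} (hB : ∀ n u, ‖fn n u‖ ≤ B)
    (hlim : ∀ u, Tendsto (fun n => fn n u) atTop (𝓝 (f u))) {φ : ℝ × ℝ → ℝ} (hφ : IsTestFunction φ) :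
    ∫ p, (f (H p) * fderiv ℝ H p (0, 1) * fderiv ℝ φ p (1, 0)
      + -(f (H p) * fderiv ℝ H p (1, 0)) * fderiv ℝ φ p (0, 1)) = 0 := by
  obtain ⟨C, hC⟩ := h.lipschitz
  have hm := fun v => hC.memLp_fderiv_apply v
  have hi := fun v => integrable_fderiv_apply hφ v
  have hc : ∀ n, AEStronglyMeasurable (fun p => fn n (H p)) volume := fun n =>
    ((hfn n).comp h.continuous).aestronglyMeasurable
  have key : Tendsto (fun n => ∫ p, (fn n (H p) * fderiv ℝ H p (0, 1) * fderiv ℝ φ p (1, 0)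
      + -(fn n (H p) * fderiv ℝ H p (1, 0)) * fderiv ℝ φ p (0, 1))) atTop
      (𝓝 (∫ p, (f (H p) * fderiv ℝ H p (0, 1) * fderiv ℝ φ p (1, 0)
      + -(f (H p) * fderiv ℝ H p (1, 0)) * fderiv ℝ φ p (0, 1)))) := by
    refine tendsto_integral_of_dominated_convergence
      (fun p => B * ‖fderiv ℝ H p (0, 1) * fderiv ℝ φ p (1, 0)‖
        + B * ‖fderiv ℝ H p (1, 0) * fderiv ℝ φ p (0, 1)‖) ?_ ?_ ?_ ?_
    · exact fun n => (((hc n).mul (hm _).1).mul (hi _).1).add (((hc n).mul (hm _).1).neg.mul (hi _).1)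
    · exact (((hm _).integrable_mul_of_top (hi _)).norm.const_mul _).add
        (((hm _).integrable_mul_of_top (hi _)).norm.const_mul _)
    · refine fun n => Eventually.of_forall fun p => (norm_add_le _ _).trans ?_
      rw [neg_mul, norm_neg, mul_assoc, mul_assoc, norm_mul, norm_mul (fn n (H p))]
      gcongr <;> exact hB n _
    · exact Eventually.of_forall fun p => (((hlim _).mul_const _).mul_const _).add
        ((((hlim _).mul_const _).neg).mul_const _)
  refine tendsto_nhds_unique key ?_
  simp_rw [fun n => h.integral_eq_zero_of_continuous (hfn n) (hB n) hφ]
  exact tendsto_const_nhds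

/-- Green's formula for functions of the stream function. -/
theorem divPairing_add_eq_zero (h : IsStreamFunction g G H) {fn : ℕ → ℝ → ℝ} {f : ℝ → ℝ}
    (hfn : ∀ n, Continuous (fn n)) {B : ℝ≥0} (hB : ∀ n u, ‖fn n u‖ ≤ B)
    (hlim : ∀ u, Tendsto (fun n => fn n u) atTop (𝓝 (f u))) {φ : ℝ × ℝ → ℝ} (hφ : IsTestFunction φ) :
    divPairing (fun p => g p * f (H p)) (fun p => G p * f (H p)) φ
      + ∫ x, deriv (fun x => H (0, x)) x * f (H (0, x)) * φ (0, x) = 0 := by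
  obtain ⟨C, hC⟩ := h.lipschitz
  have hfm : Measurable f := measurable_of_tendsto_metrizable (fun n => (hfn n).measurable)
    (tendsto_pi_nhds.2 hlim)
  have hfB : ∀ u, ‖f u‖ ≤ B := fun u =>
    le_of_tendsto (hlim u).norm (Eventually.of_forall fun n => hB n u)
  have hfH : MemLp (fun p => f (H p)) ⊤ volume :=
    memLp_top_of_bound (hfm.comp h.continuous.measurable).aestronglyMeasurable B
      (Eventually.of_forall fun p => hfB _)
  have h1 := integral_eq_divPairing_add (hfH.fun_mul_top (hC.memLp_fderiv_apply (0, 1)))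
    (Q := fun p => -(f (H p) * fderiv ℝ H p (1, 0)))
    (hfH.fun_mul_top (hC.memLp_fderiv_apply (1, 0))).neg
    (r := fun x => deriv (fun x => H (0, x)) x * f (H (0, x))) (by
      filter_upwards [h.deriv_eq_of_neg] with p hp h0
      have e : H p = H (0, p.2) := h.initial p.1 h0.le p.2
      rw [(hp h0).1, (hp h0).2, e]
      constructor <;> ring) hφ
  rw [h.integral_eq_zero_of_tendsto hfn hB hlim hφ] at h1
  refine Eq.trans ?_ h1.symm
  congr 1
  unfold divPairing
  refine integral_congr_ae ?_
  refine ae_restrict_halfPlane_iff.2 ?_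
  filter_upwards [h.deriv_eq] with p hp h0
  rw [(hp h0).1, (hp h0).2]
  ring

end IsStreamFunction

theorem exists_isStreamFunction {g G : ℝ × ℝ → ℝ} (hg : IsBoundedField g) (hG : IsBoundedField G)
    (h : ∀ φ, IsTestFunction φ → tsupport φ ⊆ Ioi 0 ×ˢ univ → divPairing g G φ = 0) :
    ∃ H, IsStreamFunction g G H :=
  let ⟨H, C, h1, h2, h3⟩ := exists_lipschitz_potential_halfPlane hg hG h
  ⟨H, ⟨C, h1⟩, h2, h3⟩

/-- The case `f = 1` of Green's formula; in particular an initial trace exists. -/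
theorem IsStreamFunction.isInitialTrace {ρ V H : ℝ × ℝ → ℝ}
    (h : IsStreamFunction ρ (fun p => ρ p * V p) H) :
    IsInitialTrace ρ V (deriv fun x => H (0, x)) := by
  refine ⟨h.memLp_trace, fun φ hφ => ?_⟩
  have := h.divPairing_add_eq_zero (fn := fun _ _ => 1) (f := fun _ => 1) (fun n => continuous_const)
    (B := 1) (by simp) (fun u => tendsto_const_nhds) hφ
  simpa using this

theorem ae_eq_of_forall_integral_trace {r r' : ℝ → ℝ} (hr : MemLp r ⊤ volume)
    (hr' : MemLp r' ⊤ volume)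
    (h : ∀ φ, IsTestFunction φ → ∫ x, r x * φ (0, x) = ∫ x, r' x * φ (0, x)) : r =ᵐ[volume] r' := by
  refine ae_eq_of_integral_contDiff_smul_eq (hr.locallyIntegrable le_top)
    (hr'.locallyIntegrable le_top) fun f hf hfc => ?_
  let χ : ContDiffBump (0 : ℝ) := ⟨1, 2, one_pos, one_lt_two⟩
  have hφ : IsTestFunction fun p : ℝ × ℝ => χ p.1 * f p.2 := by
    refine ⟨(χ.contDiff.comp contDiff_fst).mul (hf.comp contDiff_snd), ?_⟩
    refine HasCompactSupport.intro (χ.hasCompactSupport.prod hfc) fun p hp => ?_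
    by_cases h1 : p.1 ∈ tsupport χ
    · rw [image_eq_zero_of_notMem_tsupport (f := f) fun h2 => hp ⟨h1, h2⟩, mul_zero]
    · rw [image_eq_zero_of_notMem_tsupport h1, zero_mul]
  have h0 := h _ hφ
  have h1 : χ 0 = 1 := χ.one_of_mem_closedBall (by simp [χ])
  simp only [h1, one_mul] at h0
  simpa [mul_comm] using h0

/-! ### Transported quantities with zero initial trace. -/

theorem LipschitzWith.integrable_fderiv_apply {D : ℝ≥0} {f : ℝ × ℝ → ℝ} (hf : LipschitzWith D f)
    (hc : HasCompactSupport f) (v : ℝ × ℝ) : Integrable (fun p => fderiv ℝ f p v) volume :=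
  (hf.integrable_lineDeriv (μ := volume) hc v).congr
    (hf.ae_differentiableAt.mono fun _ hp => hp.lineDeriv_eq_fderiv)

theorem LipschitzWith.mul_of_bounded {X : Type*} [PseudoMetricSpace X] {f g : X → ℝ}
    {C D A B : ℝ≥0} (hf : LipschitzWith C f) (hg : LipschitzWith D g) (hA : ∀ x, ‖f x‖ ≤ A)
    (hB : ∀ x, ‖g x‖ ≤ B) : LipschitzWith (A * D + C * B) fun x => f x * g x := by
  refine LipschitzWith.of_dist_le_mul fun x y => ?_
  have h1 := hf.dist_le_mul x y
  have h2 := hg.dist_le_mul x y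
  rw [dist_eq_norm] at *
  have e : f x * g x - f y * g y = f x * (g x - g y) + (f x - f y) * g y := by ring
  rw [e]
  push_cast
  calc ‖f x * (g x - g y) + (f x - f y) * g y‖ ≤ ‖f x‖ * ‖g x - g y‖ + ‖f x - f y‖ * ‖g y‖ := by
        rw [← norm_mul, ← norm_mul]; exact norm_add_le _ _
    _ ≤ A * (D * dist x y) + (C * dist x y) * B := by
        gcongr
        exacts [hA x, hB y]
    _ = _ := by ring

/-- A nonnegative cutoff which decreases along all characteristics of speed in `[0, L]`. -/
theorem exists_transport_cutoff {L : ℝ} (hL : 0 ≤ L) (N : ℕ) :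
    ∃ φ : ℝ × ℝ → ℝ, ContDiff ℝ 1 φ ∧ HasCompactSupport φ ∧
      ∀ p : ℝ × ℝ, 0 < p.1 → ∀ V ∈ Icc 0 L,
        fderiv ℝ φ p (1, 0) + V * fderiv ℝ φ p (0, 1) ≤ 0 ∧
        ((L * N + 1) * (p.1 + 1) ^ 2 + p.2 ^ 2 < (N : ℝ) ^ 2 →
          fderiv ℝ φ p (1, 0) + V * fderiv ℝ φ p (0, 1) < 0) := by
  -- On the support of the cutoff `|x| ≤ N`, so `V * x ≥ -(L * N)`; this `A` makes `A * (t + 1) + V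
  -- * x` positive there.
  let A : ℝ := L * N + 1
  have hA : 1 ≤ A := le_add_of_nonneg_left (by positivity)
  -- `Θ u` is half the square of the positive part of `u`: it is `C¹` and vanishes for `u ≤ 0`.
  let Θ : ℝ → ℝ := fun u => ∫ s in (0 : ℝ)..u, max s 0
  have hm : Continuous fun s : ℝ => max s 0 := continuous_id.max continuous_const
  have hΘ : ∀ u, HasDerivAt Θ (max u 0) u := fun u =>
    intervalIntegral.integral_hasDerivAt_right (hm.intervalIntegrable _ _)
      (hm.stronglyMeasurableAtFilter _ _) hm.continuousAt
  have hΘ0 : ∀ u ≤ 0, Θ u = 0 := by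
    intro u hu
    refine intervalIntegral.integral_zero_ae (Eventually.of_forall fun s hs => ?_)
    rw [uIoc_of_ge hu] at hs
    exact max_eq_right hs.2
  have hΘc : ContDiff ℝ 1 Θ := contDiff_one_iff_deriv.2
    ⟨fun u => (hΘ u).differentiableAt, by simpa only [funext fun u => (hΘ u).deriv] using hm⟩
  let q : ℝ × ℝ → ℝ := fun p => (N : ℝ) ^ 2 - (A * (p.1 + 1) ^ 2 + p.2 ^ 2)
  have hqc : ContDiff ℝ 1 q := contDiff_const.sub ((contDiff_const.mul
    ((contDiff_fst.add contDiff_const).pow 2)).add (contDiff_snd.pow 2))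
  have hqd : ∀ p : ℝ × ℝ, HasFDerivAt q (planeForm (-(2 * A * (p.1 + 1))) (-(2 * p.2))) p := by
    intro p
    have hf : HasFDerivAt (fun p : ℝ × ℝ => p.1) (ContinuousLinearMap.fst ℝ ℝ ℝ) p := hasFDerivAt_fst
    have hs : HasFDerivAt (fun p : ℝ × ℝ => p.2) (ContinuousLinearMap.snd ℝ ℝ ℝ) p := hasFDerivAt_snd
    have h1 : HasFDerivAt (fun p : ℝ × ℝ => A * (p.1 + 1) ^ 2 + p.2 ^ 2) _ p :=
      (((hf.add_const (1 : ℝ)).pow 2).const_mul A).add (hs.pow 2)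
    refine (h1.const_sub ((N : ℝ) ^ 2)).congr_fderiv ?_
    ext
    · simp [planeForm_apply]; ring
    · simp [planeForm_apply]
  have hφd : ∀ p v, fderiv ℝ (fun p => Θ (q p)) p v
      = max (q p) 0 * (-(2 * A * (p.1 + 1)) * v.1 + -(2 * p.2) * v.2) := by
    intro p v
    have h1 : fderiv ℝ (fun p => Θ (q p)) p = _ := ((hΘ (q p)).comp_hasFDerivAt p (hqd p)).fderiv
    rw [h1, _root_.smul_apply, planeForm_apply, smul_eq_mul]
  refine ⟨fun p => Θ (q p), hΘc.comp hqc, ?_, ?_⟩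
  · refine HasCompactSupport.intro ((isCompact_Icc (a := -(N : ℝ) - 1) (b := N)).prod
      (isCompact_Icc (a := -(N : ℝ)) (b := N))) fun p hp => hΘ0 _ ?_
    by_contra! h
    have h0 : 0 < (N : ℝ) ^ 2 - (A * (p.1 + 1) ^ 2 + p.2 ^ 2) := h
    have hN : (0 : ℝ) ≤ N := Nat.cast_nonneg N
    have h1 : (p.1 + 1) ^ 2 ≤ (N : ℝ) ^ 2 := by
      nlinarith [mul_nonneg (sub_nonneg.2 hA) (sq_nonneg (p.1 + 1)), sq_nonneg p.2]
    have h2 : p.2 ^ 2 ≤ (N : ℝ) ^ 2 := by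
      nlinarith [mul_nonneg (sub_nonneg.2 hA) (sq_nonneg (p.1 + 1)), sq_nonneg (p.1 + 1)]
    obtain ⟨h3, h4⟩ := abs_le.1 (abs_le_of_sq_le_sq h1 hN)
    obtain ⟨h5, h6⟩ := abs_le.1 (abs_le_of_sq_le_sq h2 hN)
    exact hp ⟨⟨by linarith, by linarith⟩, ⟨h5, h6⟩⟩
  · intro p hp V hV
    have e : fderiv ℝ (fun p => Θ (q p)) p (1, 0) + V * fderiv ℝ (fun p => Θ (q p)) p (0, 1)
        = - (max (q p) 0 * (2 * (A * (p.1 + 1) + V * p.2))) := by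
      rw [hφd, hφd]; ring
    rw [e]
    have hpos : 0 < q p → 0 < A * (p.1 + 1) + V * p.2 := by
      intro h
      have h0 : 0 < (N : ℝ) ^ 2 - (A * (p.1 + 1) ^ 2 + p.2 ^ 2) := h
      have hN : (0 : ℝ) ≤ N := Nat.cast_nonneg N
      have h2 : p.2 ^ 2 ≤ (N : ℝ) ^ 2 := by
        nlinarith [mul_nonneg (sub_nonneg.2 hA) (sq_nonneg (p.1 + 1)), sq_nonneg (p.1 + 1)]
      obtain ⟨h5, -⟩ := abs_le.1 (abs_le_of_sq_le_sq h2 hN)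
      have h6 : -(L * N) ≤ V * p.2 := by
        calc -(L * N) ≤ -(V * N) := neg_le_neg (mul_le_mul_of_nonneg_right hV.2 hN)
          _ = V * -N := by ring
          _ ≤ V * p.2 := mul_le_mul_of_nonneg_left h5 hV.1
      have h7 : A ≤ A * (p.1 + 1) := le_mul_of_one_le_right (by linarith) (by linarith)
      have h8 : A = L * N + 1 := rfl
      linarith
    refine ⟨neg_nonpos.2 ?_, fun h => neg_neg_of_pos ?_⟩
    · rcases le_or_gt (q p) 0 with h | h
      · rw [max_eq_right h, zero_mul]
      · exact mul_nonneg (le_max_right _ _) (by linarith [hpos h])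
    · have hq : 0 < q p := sub_pos.2 h
      rw [max_eq_left hq.le]
      exact mul_pos hq (by linarith [hpos hq])

/-- Bounded transported quantities with vanishing initial trace vanish. -/
theorem IsStreamFunction.ae_mul_eq_zero {ρ V H v : ℝ × ℝ → ℝ} (hρ : IsBoundedField ρ)
    (hV : IsBoundedField V) (hρ0 : ∀ᵐ p ∂(volume.restrict halfPlane), 0 ≤ ρ p)
    (hV0 : ∀ᵐ p ∂(volume.restrict halfPlane), 0 ≤ V p)
    (hH : IsStreamFunction ρ (fun p => ρ p * V p) H) (hv : IsBoundedField v)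
    (hw : ∀ φ, IsTestFunction φ → divPairing (fun p => ρ p * v p) (fun p => ρ p * V p * v p) φ = 0) :
    ∀ᵐ p : ℝ × ℝ, 0 < p.1 → ρ p * v p = 0 := by
  obtain ⟨L, hL⟩ := exists_ae_bound_of_memLp_top hV
  rw [ae_restrict_halfPlane_iff] at hρ0 hV0 hL
  obtain ⟨K', hK'⟩ := exists_isStreamFunction (hρ.fun_mul_top hv) ((hρ.fun_mul_top hV).fun_mul_top hv)
    fun φ hφ _ => hw φ hφ
  obtain ⟨C', hC'⟩ := hK'.lipschitz
  obtain ⟨D, hD⟩ := hH.lipschitz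
  -- the initial values of the stream function are constant
  have htr : (deriv fun x => K' (0, x)) =ᵐ[volume] fun _ => (0 : ℝ) := by
    refine ae_eq_of_forall_integral_trace hK'.memLp_trace (memLp_top_const 0) fun φ hφ => ?_
    have h1 := hK'.divPairing_add_eq_zero (fn := fun _ _ => 1) (f := fun _ => 1)
      (fun n => continuous_const) (B := 1) (by simp) (fun u => tendsto_const_nhds) hφ
    simp only [mul_one, hw φ hφ, zero_add] at h1
    simp [h1]
  have hconst : ∀ x, K' (0, x) = K' (0, 0) := by
    intro x
    have h1 : LipschitzWith (C' * 1) fun x => K' (0, x) := hC'.comp (LipschitzWith.prodMk_left 0)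
    have h2 := h1.eq_of_ae_lineDeriv_eq_zero (μ := volume) isOpen_univ convex_univ (v := x) (by
      filter_upwards [htr, h1.ae_differentiableAt] with y hy hyd _
      rw [hyd.lineDeriv_eq_fderiv, fderiv_eq_smul_deriv, hy, smul_zero]) (mem_univ 0) (mem_univ _)
    simpa using h2
  let K : ℝ × ℝ → ℝ := fun p => K' p - K' (0, 0)
  have hK : LipschitzWith C' K := LipschitzWith.of_dist_le_mul fun p q => by
    simpa [K] using hC'.dist_le_mul p q
  have hK0 : ∀ p : ℝ × ℝ, p.1 ≤ 0 → K p = 0 := by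
    intro p hp
    have : K' p = K' (0, p.2) := hK'.initial p.1 hp p.2
    simp only [K, this, hconst, sub_self]
  have hKd : ∀ᵐ p : ℝ × ℝ, 0 < p.1 →
      fderiv ℝ K p (0, 1) = ρ p * v p ∧ fderiv ℝ K p (1, 0) = - (ρ p * V p * v p) := by
    filter_upwards [hK'.deriv_eq] with p hp h0
    rw [show fderiv ℝ K p = fderiv ℝ K' p from fderiv_sub_const _]
    exact hp h0
  have hKneg : ∀ p : ℝ × ℝ, p.1 < 0 → fderiv ℝ K p = 0 := by
    intro p hp
    have : K =ᶠ[𝓝 p] fun _ => (0 : ℝ) := by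
      filter_upwards [(isOpen_lt continuous_fst continuous_const).mem_nhds hp] with z hz
      exact hK0 z (le_of_lt hz)
    rw [this.fderiv_eq]; simp
  -- a function of the new stream function vanishes on the support of `ρ`
  let b : ℝ × ℝ → ℝ := fun p => 1 - Real.cos (K p)
  have hb0 : ∀ p, 0 ≤ b p := fun p => sub_nonneg.2 (Real.cos_le_one _)
  have hbL : LipschitzWith (0 + 1 * C') b :=
    (LipschitzWith.const (1 : ℝ)).sub (Real.lipschitzWith_cos.comp hK)
  have hb2 : ∀ p, ‖b p‖ ≤ (2 : ℝ≥0) := fun p => by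
    rw [Real.norm_of_nonneg (hb0 p)]
    show 1 - Real.cos (K p) ≤ 2
    linarith [Real.neg_one_le_cos (K p)]
  -- The curl identity for `H` is tested with `b * φ`. The choice `1 - cos` keeps `b` bounded,
  -- nonnegative and Lipschitz, with `b = 0` at nonpositive times.
  have hbρ : ∀ N : ℕ, ∀ᵐ p : ℝ × ℝ, 0 < p.1 →
      ((L : ℝ) * N + 1) * (p.1 + 1) ^ 2 + p.2 ^ 2 < (N : ℝ) ^ 2 → b p * ρ p = 0 := by
    intro N
    obtain ⟨φ, hφ1, hφc, hφ⟩ := exists_transport_cutoff L.coe_nonneg N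
    obtain ⟨M, hM⟩ := ContDiff.lipschitzWith_of_hasCompactSupport hφc hφ1 one_ne_zero
    obtain ⟨B, hB⟩ := hφc.exists_bound_of_continuous hφ1.continuous
    have hB' : ∀ p, ‖φ p‖ ≤ B.toNNReal := fun p => (hB p).trans (Real.le_coe_toNNReal B)
    have hψ := hbL.mul_of_bounded hM hb2 hB'
    have hψc : HasCompactSupport fun p => b p * φ p := hφc.mul_left
    have h0 := hD.integral_curl_eq_zero hψ hψc
    have hi : Integrable (fun p => fderiv ℝ H p (0, 1) * fderiv ℝ (fun p => b p * φ p) p (1, 0)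
        - fderiv ℝ H p (1, 0) * fderiv ℝ (fun p => b p * φ p) p (0, 1)) volume :=
      ((hD.memLp_fderiv_apply _).integrable_mul_of_top (hψ.integrable_fderiv_apply hψc _)).sub
        ((hD.memLp_fderiv_apply _).integrable_mul_of_top (hψ.integrable_fderiv_apply hψc _))
    have hψd : ∀ᵐ p : ℝ × ℝ, ∀ w, fderiv ℝ (fun p => b p * φ p) p w
        = b p * fderiv ℝ φ p w + φ p * (Real.sin (K p) * fderiv ℝ K p w) := by
      filter_upwards [hK.ae_differentiableAt] with p hp w
      have h1 : HasFDerivAt b _ p := hp.hasFDerivAt.cos.const_sub 1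
      have h2 := (h1.mul (hφ1.differentiable one_ne_zero p).hasFDerivAt).fderiv
      have h3 : fderiv ℝ (fun p => b p * φ p) p = _ := h2
      rw [h3]; simp
    -- The terms with derivatives of `b` cancel because `∇K = v∇H`. What remains has a sign by the
    -- choice of `φ`, while its integral is zero.
    have hpos : ∀ᵐ p : ℝ × ℝ, 0 < p.1 →
        fderiv ℝ H p (0, 1) * fderiv ℝ (fun p => b p * φ p) p (1, 0)
        - fderiv ℝ H p (1, 0) * fderiv ℝ (fun p => b p * φ p) p (0, 1)
        = b p * ρ p * (fderiv ℝ φ p (1, 0) + V p * fderiv ℝ φ p (0, 1)) := by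
      filter_upwards [hψd, hH.deriv_eq, hKd] with p h1 h2 h3 hp
      rw [h1, h1, (h2 hp).1, (h2 hp).2, (h3 hp).1, (h3 hp).2]
      ring
    have hneg : ∀ᵐ p : ℝ × ℝ, p.1 < 0 →
        fderiv ℝ H p (0, 1) * fderiv ℝ (fun p => b p * φ p) p (1, 0)
        - fderiv ℝ H p (1, 0) * fderiv ℝ (fun p => b p * φ p) p (0, 1) = 0 := by
      filter_upwards [hψd] with p h1 hp
      have hbp : b p = 0 := by simp [b, hK0 p hp.le]
      rw [h1, h1, hKneg p hp, hbp]
      simp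
    have hle : 0 ≤ᵐ[volume] fun p => -(fderiv ℝ H p (0, 1) * fderiv ℝ (fun p => b p * φ p) p (1, 0)
        - fderiv ℝ H p (1, 0) * fderiv ℝ (fun p => b p * φ p) p (0, 1)) := by
      filter_upwards [hpos, hneg, ae_fst_ne_zero, hρ0, hV0, hL] with p h1 h2 h3 h4 h5 h6
      rcases lt_or_gt_of_ne h3 with hp | hp
      · simp [h2 hp]
      · rw [h1 hp]
        have hVp : V p ∈ Icc (0 : ℝ) L := ⟨h5 hp, (le_abs_self _).trans (h6 hp)⟩
        exact neg_nonneg.2 (mul_nonpos_of_nonneg_of_nonpos (mul_nonneg (hb0 p) (h4 hp))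
          (hφ p hp _ hVp).1)
    have hz := (integral_eq_zero_iff_of_nonneg_ae hle hi.neg).1 (by rw [integral_neg, h0, neg_zero])
    filter_upwards [hz, hpos, hρ0, hV0, hL] with p h1 h2 h4 h5 h6 hp hN
    have hVp : V p ∈ Icc (0 : ℝ) L := ⟨h5 hp, (le_abs_self _).trans (h6 hp)⟩
    have h7 := (hφ p hp _ hVp).2 hN
    have h8 : -(b p * ρ p * (fderiv ℝ φ p (1, 0) + V p * fderiv ℝ φ p (0, 1))) = 0 := by
      rw [← h2 hp]; exact h1
    exact (mul_eq_zero.1 (neg_eq_zero.1 h8)).resolve_right h7.ne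
  have hbρ' : ∀ᵐ p : ℝ × ℝ, 0 < p.1 → b p * ρ p = 0 := by
    filter_upwards [ae_all_iff.2 hbρ] with p hp h0
    -- The regions exhaust the half-plane: `N ^ 2` outgrows `(L * N + 1) * (t + 1) ^ 2 + x ^ 2`,
    -- which is linear in `N`.
    have hlim : Tendsto (fun N : ℕ => (N : ℝ) * ((N : ℝ) - L * (p.1 + 1) ^ 2)) atTop atTop :=
      tendsto_natCast_atTop_atTop.atTop_mul_atTop₀
        (tendsto_atTop_add_const_right _ _ tendsto_natCast_atTop_atTop)
    obtain ⟨N, hN⟩ := (hlim.eventually_gt_atTop ((p.1 + 1) ^ 2 + p.2 ^ 2)).exists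
    exact hp N h0 (by nlinarith)
  -- hence the new stream function is constant
  have hKzero : ∀ p, K p = 0 := by
    -- `∇F = b∇K`, and `∇K` is a multiple of `ρ`, so `b * ρ = 0` makes `F` constant. Since `z - sin
    -- z` vanishes only at 0, `K` vanishes too.
    let F : ℝ × ℝ → ℝ := fun p => K p - Real.sin (K p)
    have hF : LipschitzWith (C' + 1 * C') F := hK.sub (Real.lipschitzWith_sin.comp hK)
    have hF0 : ∀ w : ℝ × ℝ, ∀ᵐ q : ℝ × ℝ, q ∈ univ → lineDeriv ℝ F q w = 0 := by
      intro w
      filter_upwards [hK.ae_differentiableAt, hF.ae_differentiableAt, hbρ', hKd, ae_fst_ne_zero]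
        with q h1 h2 h3 h4 h5 _
      have h6 : HasFDerivAt F _ q := h1.hasFDerivAt.sub h1.hasFDerivAt.sin
      rw [h2.lineDeriv_eq_fderiv, h6.fderiv]
      have h7 : (fderiv ℝ K q - Real.cos (K q) • fderiv ℝ K q) w = b q * fderiv ℝ K q w := by
        simp [b]; ring
      rw [h7]
      rcases lt_or_gt_of_ne h5 with hp | hp
      · simp [hKneg q hp]
      · rw [clm_eq_planeForm (fderiv ℝ K q), planeForm_apply, (h4 hp).1, (h4 hp).2]
        linear_combination (v q * w.2 - V q * v q * w.1) * h3 hp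
    intro p
    have h1 := hF.eq_of_ae_lineDeriv_eq_zero isOpen_univ convex_univ (hF0 p) (mem_univ 0)
      (mem_univ _)
    have h2 : F p = 0 := by
      rw [zero_add] at h1
      rw [h1]
      simp [F, hK0 0 le_rfl]
    by_contra hne
    have h3 := Real.abs_sin_lt_abs hne
    rw [← sub_eq_zero.1 h2] at h3
    exact lt_irrefl _ h3
  filter_upwards [hKd] with p hp h0
  rw [← (hp h0).1, show K = fun _ => (0 : ℝ) from funext hKzero]
  simp

/-! ### Monotonicity of the stream function and its level curves. -/

theorem IsStreamFunction.neg {g G H : ℝ × ℝ → ℝ} (h : IsStreamFunction g G H) :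
    IsStreamFunction (fun p => - g p) (fun p => - G p) (fun p => - H p) := by
  obtain ⟨C, hC⟩ := h.lipschitz
  refine ⟨⟨C, hC.neg⟩, fun t ht x => by rw [h.initial t ht], ?_⟩
  filter_upwards [h.deriv_eq] with p hp h0
  rw [fderiv_fun_neg]
  simp [hp h0]

/-- A stream function of a field with nonnegative density and velocity in `[0, L]` increases in
space, decreases in time, and increases along lines of speed `L`. -/
theorem IsStreamFunction.monotonicity {ρ V H : ℝ × ℝ → ℝ} {L : ℝ≥0}
    (h : IsStreamFunction ρ (fun p => ρ p * V p) H) (hρ : ∀ᵐ p : ℝ × ℝ, 0 < p.1 → 0 ≤ ρ p)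
    (hV : ∀ᵐ p : ℝ × ℝ, 0 < p.1 → 0 ≤ V p) (hL : ∀ᵐ p : ℝ × ℝ, 0 < p.1 → ‖V p‖ ≤ L) {t : ℝ}
    (ht : 0 ≤ t) :
    (∀ x y, x ≤ y → H (t, x) ≤ H (t, y)) ∧ (∀ x s, 0 ≤ s → H (t + s, x) ≤ H (t, x)) ∧
      ∀ x s, 0 ≤ s → H (t, x) ≤ H (t + s, x + L * s) := by
  refine ⟨fun x y hxy => ?_, fun x s hs => ?_, fun x s hs => ?_⟩
  · have := h.le_add (v := (0, y - x)) le_rfl (by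
      filter_upwards [hρ] with p hp h0
      simpa using mul_nonneg (hp h0) (sub_nonneg.2 hxy)) (p := (t, x)) ht
    simpa using this
  · have := h.neg.le_add (v := (s, 0)) hs (by
      filter_upwards [hρ, hV] with p hp hp' h0
      simpa using mul_nonneg (mul_nonneg (hp h0) (hp' h0)) hs) (p := (t, x)) ht
    simpa using this
  · have := h.le_add (v := (s, L * s)) hs (by
      filter_upwards [hρ, hL] with p hp hp' h0
      have h1 : V p ≤ L := (le_abs_self _).trans (hp' h0)
      have h2 := mul_nonneg (mul_nonneg (hp h0) (sub_nonneg.2 h1)) hs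
      show 0 ≤ -(ρ p * V p) * s + ρ p * (L * s)
      nlinarith) (p := (t, x)) ht
    simpa using this

/-- Level sets of a function which increases in space, decreases in time, and increases along lines
of speed `L` are Lipschitz graphs. -/
theorem exists_level_curve {H : ℝ × ℝ → ℝ} (hc : Continuous H) {L : ℝ≥0}
    (hmono : ∀ t, 0 ≤ t → ∀ x y, x ≤ y → H (t, x) ≤ H (t, y))
    (hanti : ∀ t, 0 ≤ t → ∀ x s, 0 ≤ s → H (t + s, x) ≤ H (t, x))
    (hspeed : ∀ t, 0 ≤ t → ∀ x s, 0 ≤ s → H (t, x) ≤ H (t + s, x + L * s)) {h : ℝ}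
    (hlow : ∃ x, H (0, x) < h) (hup : ∃ x, h ≤ H (0, x)) :
    ∃ Y : ℝ → ℝ, LipschitzOnWith L Y (Ici 0) ∧ (∀ s, 0 ≤ s → Y 0 ≤ Y s) ∧
      (∀ s, 0 ≤ s → H (s, Y s) = h) ∧ ∀ s, 0 ≤ s → ∀ x, h ≤ H (s, x) ↔ Y s ≤ x := by
  obtain ⟨x₀, hx₀⟩ := hlow
  obtain ⟨x₁, hx₁⟩ := hup
  -- The curve is the supremum of the strict sublevel set; this set is bounded above because `h` is
  -- reached at `x₁` and persists along the line of speed `L` from there.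
  let A : ℝ → Set ℝ := fun s => {x | H (s, x) < h}
  have hne : ∀ s, 0 ≤ s → (A s).Nonempty := fun s hs =>
    ⟨x₀, by simpa [A] using (hanti 0 le_rfl x₀ s hs).trans_lt hx₀⟩
  have hbdd : ∀ s, 0 ≤ s → BddAbove (A s) := by
    refine fun s hs => ⟨x₁ + L * s, fun x hx => ?_⟩
    by_contra! hlt
    have h1 := hspeed 0 le_rfl x₁ s hs
    rw [zero_add] at h1
    have hx' : H (s, x) < h := hx
    linarith [hmono s hs _ _ hlt.le]
  have hiff : ∀ s, 0 ≤ s → ∀ x, h ≤ H (s, x) ↔ sSup (A s) ≤ x := by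
    intro s hs x
    constructor
    · intro hx
      refine csSup_le (hne s hs) fun y hy => ?_
      by_contra! hlt
      have hy' : H (s, y) < h := hy
      linarith [hmono s hs _ _ hlt.le]
    · intro hx
      by_contra! hlt
      have ho : IsOpen (A s) :=
        isOpen_lt (hc.comp (continuous_const.prodMk continuous_id)) continuous_const
      have hmem : A s ∩ Ioi x ∈ 𝓝[>] x :=
        inter_mem (mem_nhdsWithin_of_mem_nhds (ho.mem_nhds hlt)) self_mem_nhdsWithin
      obtain ⟨y, hy, hxy⟩ := Filter.nonempty_of_mem hmem
      exact absurd (le_csSup (hbdd s hs) hy) (not_le.2 (hx.trans_lt (mem_Ioi.1 hxy)))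
  have hle : ∀ s, 0 ≤ s → ∀ t, s ≤ t →
      sSup (A s) ≤ sSup (A t) ∧ sSup (A t) ≤ sSup (A s) + L * (t - s) := by
    intro s hs t hst
    have ht : s + (t - s) = t := by ring
    constructor
    · refine (hiff s hs _).1 ?_
      have h1 := hanti s hs (sSup (A t)) (t - s) (sub_nonneg.2 hst)
      rw [ht] at h1
      exact ((hiff t (hs.trans hst) _).2 le_rfl).trans h1
    · refine (hiff t (hs.trans hst) _).1 ?_
      have h1 := hspeed s hs (sSup (A s)) (t - s) (sub_nonneg.2 hst)
      rw [ht] at h1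
      exact ((hiff s hs _).2 le_rfl).trans h1
  refine ⟨fun s => sSup (A s), ?_, fun s hs => (hle 0 le_rfl s hs).1, fun s hs => ?_, hiff⟩
  · refine LipschitzOnWith.of_dist_le_mul fun s hs t ht => ?_
    rw [Real.dist_eq, Real.dist_eq]
    rcases le_total s t with hst | hst
    · obtain ⟨h1, h2⟩ := hle s hs t hst
      rw [abs_of_nonpos (sub_nonpos.2 h1), abs_of_nonpos (sub_nonpos.2 hst)]
      linarith
    · obtain ⟨h1, h2⟩ := hle t ht s hst
      rw [abs_of_nonneg (sub_nonneg.2 h1), abs_of_nonneg (sub_nonneg.2 hst)]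
      linarith
  · refine le_antisymm ?_ ((hiff s hs _).2 le_rfl)
    have hcl : IsClosed {x | H (s, x) ≤ h} :=
      isClosed_le (hc.comp (continuous_const.prodMk continuous_id)) continuous_const
    have hsub : Iio (sSup (A s)) ⊆ {x | H (s, x) ≤ h} := by
      intro x hx
      by_contra h'
      exact absurd ((hiff s hs x).1 (not_le.1 h').le) (not_le.2 hx)
    refine closure_minimal hsub hcl ?_
    rw [closure_Iio]
    exact mem_Iic.2 le_rfl

/-! ### Step data, existence and comparison of weak solutions. -/

/-- Shows that the initial density vanishes where `H(0, ·)` is flat to the right. Without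
differentiability, `deriv` is 0 by convention. -/
theorem deriv_eq_zero_of_eq_on_Icc {f : ℝ → ℝ} {x y : ℝ} (hxy : x < y)
    (h : ∀ z ∈ Icc x y, f z = f x) : deriv f x = 0 := by
  by_cases hd : DifferentiableAt ℝ f x
  · have h1 : HasDerivWithinAt f (deriv f x) (Icc x y) x := hd.hasDerivAt.hasDerivWithinAt
    have h2 : HasDerivWithinAt f 0 (Icc x y) x :=
      (hasDerivWithinAt_const x (Icc x y) (f x)).congr h rfl
    exact (uniqueDiffOn_Icc hxy x (left_mem_Icc.2 hxy.le)).eq_deriv _ h1 h2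
  · exact deriv_zero_of_not_differentiableAt hd

/-- The indices with `d i ≤ x` form an initial segment, whose size is the index of the value at `x`;
the sum then telescopes. -/
theorem IsStepFunction.eq_sum {M : ℕ} {d : Fin M → ℝ} {a : Fin (M + 1) → ℝ} {w₀ : ℝ → ℝ}
    (h : IsStepFunction d a w₀) (x : ℝ) :
    w₀ x = a 0 + ∑ i : Fin M, (a i.succ - a i.castSucc) * if d i ≤ x then 1 else 0 := by
  classical
  let s : Finset (Fin M) := Finset.univ.filter fun i => d i ≤ x
  have hs : ∀ i : Fin M, (i : ℕ) < s.card ↔ d i ≤ x := by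
    intro i
    constructor
    · intro hi
      by_contra hlt
      have hsub : s ⊆ Finset.Iio i := fun j hj => by
        have hj' : d j ≤ x := (Finset.mem_filter.1 hj).2
        exact Finset.mem_Iio.2 (h.ordered.lt_iff_lt.1 (hj'.trans_lt (not_le.1 hlt)))
      have := Finset.card_le_card hsub
      rw [Fin.card_Iio] at this
      omega
    · intro hi
      have hsub : Finset.Iic i ⊆ s := fun j hj =>
        Finset.mem_filter.2 ⟨Finset.mem_univ _, (h.ordered.monotone (Finset.mem_Iic.1 hj)).trans hi⟩
      have := Finset.card_le_card hsub
      rw [Fin.card_Iic] at this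
      omega
  have hsM : s.card ≤ M := by simpa using s.card_le_univ
  have hval := h.eq_value ⟨s.card, by omega⟩ x (fun i hi => (hs i).1 hi) fun i hi => by
    by_contra hlt
    exact absurd ((hs i).2 (not_lt.1 hlt)) (not_lt.2 hi)
  let b : ℕ → ℝ := fun k => if hk : k < M + 1 then a ⟨k, hk⟩ else 0
  have hb : ∀ k (hk : k < M + 1), b k = a ⟨k, hk⟩ := fun k hk => dif_pos hk
  have e1 : ∑ i : Fin M, (a i.succ - a i.castSucc) * (if d i ≤ x then (1 : ℝ) else 0)
      = ∑ i : Fin M, (b ((i : ℕ) + 1) - b i) * if (i : ℕ) < s.card then 1 else 0 := by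
    refine Finset.sum_congr rfl fun i _ => ?_
    rw [hb _ (Nat.succ_lt_succ i.2), hb _ (i.2.trans (Nat.lt_succ_self _))]
    simp only [hs]
    rfl
  rw [e1, Fin.sum_univ_eq_sum_range
    (fun i => (b (i + 1) - b i) * if i < s.card then (1 : ℝ) else 0) M]
  have e2 : ∑ i ∈ Finset.range M, (b (i + 1) - b i) * (if i < s.card then (1 : ℝ) else 0)
      = ∑ i ∈ Finset.range s.card, (b (i + 1) - b i) := by
    simp only [mul_ite, mul_one, mul_zero]
    rw [← Finset.sum_filter]
    congr 1
    ext i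
    simp only [Finset.mem_filter, Finset.mem_range]
    omega
  rw [e2, Finset.sum_range_sub, hval, hb _ (by omega), hb 0 (by omega)]
  simp

/-- The step function with value `α` at `-∞` and jumps `c i` at the points `h i`. -/
noncomputable def jumpSum {M : ℕ} (α : ℝ) (c h : Fin M → ℝ) (u : ℝ) : ℝ :=
  α + ∑ i, c i * if h i ≤ u then 1 else 0

/-- The ramps lie to the left of the jumps, so convergence holds at every point, the jump points
included. -/
theorem exists_continuous_tendsto_jumpSum {M : ℕ} (α : ℝ) (c h : Fin M → ℝ) :
    ∃ (fn : ℕ → ℝ → ℝ) (B : ℝ≥0), (∀ n, Continuous (fn n)) ∧ (∀ n u, ‖fn n u‖ ≤ B) ∧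
      ∀ u, Tendsto (fun n => fn n u) atTop (𝓝 (jumpSum α c h u)) := by
  let r : ℕ → ℝ → ℝ := fun n z => max 0 (min 1 (n * z + 1))
  have hr : ∀ n z, ‖r n z‖ ≤ 1 := fun n z => by
    rw [Real.norm_of_nonneg (le_max_left _ _)]
    exact max_le zero_le_one (min_le_left _ _)
  have hrc : ∀ n, Continuous (r n) := fun n => by fun_prop
  refine ⟨fun n u => α + ∑ i, c i * r n (u - h i), ‖α‖₊ + ∑ i, ‖c i‖₊, fun n => by fun_prop,
    fun n u => ?_, fun u => ?_⟩
  · push_cast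
    refine (norm_add_le _ _).trans (add_le_add le_rfl ((norm_sum_le _ _).trans ?_))
    refine Finset.sum_le_sum fun i _ => ?_
    rw [norm_mul]
    exact mul_le_of_le_one_right (norm_nonneg _) (hr _ _)
  · refine tendsto_const_nhds.add (tendsto_finsetSum _ fun i _ => Tendsto.const_mul _ ?_)
    split_ifs with hu
    · refine tendsto_const_nhds.congr fun n => ?_
      have : 0 ≤ (n : ℝ) * (u - h i) := mul_nonneg n.cast_nonneg (sub_nonneg.2 hu)
      simp only [r]
      rw [min_eq_left (by linarith), max_eq_right zero_le_one]
    · refine tendsto_const_nhds.congr' ?_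
      have hpos : 0 < h i - u := sub_pos.2 (not_le.1 hu)
      obtain ⟨N, hN⟩ := exists_nat_gt (1 / (h i - u))
      filter_upwards [eventually_ge_atTop N] with n hn
      have h1 : (N : ℝ) ≤ n := by exact_mod_cast hn
      have h2 : 1 < n * (h i - u) := (div_lt_iff₀ hpos).1 (hN.trans_le h1)
      simp only [r]
      rw [max_eq_left ((min_le_right _ _).trans (by nlinarith))]

/-- Functions of the stream function are weak solutions. -/
theorem IsStreamFunction.isWeakSolution {ρ V H : ℝ × ℝ → ℝ} {M : ℕ} {d : Fin M → ℝ}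
    {a : Fin (M + 1) → ℝ} {w₀ : ℝ → ℝ} (h : IsStreamFunction ρ (fun p => ρ p * V p) H)
    (hmono : ∀ x y, x ≤ y → H (0, x) ≤ H (0, y)) (hw₀ : IsStepFunction d a w₀) :
    IsWeakSolution ρ V w₀ fun p =>
      jumpSum (a 0) (fun i => a i.succ - a i.castSucc) (fun i => H (0, d i)) (H p) := by
  obtain ⟨fn, B, hfn, hB, hlim⟩ := exists_continuous_tendsto_jumpSum (a 0)
    (fun i : Fin M => a i.succ - a i.castSucc) fun i => H (0, d i)
  refine ⟨?_, _, h.isInitialTrace, fun φ hφ => ?_⟩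
  · have hm : Measurable (jumpSum (a 0) (fun i : Fin M => a i.succ - a i.castSucc)
        fun i => H (0, d i)) :=
      measurable_of_tendsto_metrizable (fun n => (hfn n).measurable) (tendsto_pi_nhds.2 hlim)
    exact memLp_top_of_bound (hm.comp h.continuous.measurable).aestronglyMeasurable B
      (Eventually.of_forall fun p => le_of_tendsto (hlim _).norm
        (Eventually.of_forall fun n => hB n _))
  · refine Eq.trans ?_ (h.divPairing_add_eq_zero hfn hB hlim hφ)
    refine congrArg _ (integral_congr_ae (Eventually.of_forall fun x => ?_))
    refine congrArg (· * φ (0, x)) ?_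
    -- The conditions `d i ≤ x` and `H (0, d i) ≤ H (0, x)` differ only if `H(0, ·)` is flat on `[x,
    -- d i]`, and there the initial density is zero.
    by_cases h0 : deriv (fun x => H (0, x)) x = 0
    · rw [h0, zero_mul, zero_mul]
    · rw [hw₀.eq_sum x, jumpSum]
      have hiff : ∀ i, d i ≤ x ↔ H (0, d i) ≤ H (0, x) := by
        refine fun i => ⟨hmono _ _, fun hi => ?_⟩
        by_contra! hlt
        refine h0 (deriv_eq_zero_of_eq_on_Icc (f := fun x => H (0, x)) hlt fun z hz => ?_)
        exact le_antisymm ((hmono _ _ hz.2).trans hi) (hmono _ _ hz.1)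
      simp only [hiff]

/-- Weak solutions with the same initial datum agree where the density does not vanish. -/
theorem IsWeakSolution.ae_eq {ρ V w w' : ℝ × ℝ → ℝ} {w₀ : ℝ → ℝ} {H : ℝ × ℝ → ℝ}
    (hρ : IsBoundedField ρ) (hV : IsBoundedField V)
    (hρ0 : ∀ᵐ p ∂(volume.restrict halfPlane), 0 ≤ ρ p)
    (hV0 : ∀ᵐ p ∂(volume.restrict halfPlane), 0 ≤ V p)
    (hH : IsStreamFunction ρ (fun p => ρ p * V p) H) (hw : IsWeakSolution ρ V w₀ w)
    (hw' : IsWeakSolution ρ V w₀ w') :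
    ∀ᵐ p ∂(volume.restrict halfPlane), ρ p ≠ 0 → w' p = w p := by
  obtain ⟨hb, r, ⟨hr, htr⟩, hφ⟩ := hw
  obtain ⟨hb', r', ⟨hr', htr'⟩, hφ'⟩ := hw'
  -- Each weak solution comes with its own representative of the trace; these must be identified
  -- before subtracting.
  have hrr : r =ᵐ[volume] r' := ae_eq_of_forall_integral_trace hr hr' fun φ h => by
    linarith [htr φ h, htr' φ h]
  have key := hH.ae_mul_eq_zero hρ hV hρ0 hV0 (v := fun p => w' p - w p) (hb'.sub hb) (by
    intro φ h
    have e1 : ∫ x, r x * w₀ x * φ (0, x) = ∫ x, r' x * w₀ x * φ (0, x) :=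
      integral_congr_ae (hrr.mono fun x hx => by simp only [hx])
    have e2 : divPairing (fun p => ρ p * (w' p - w p)) (fun p => ρ p * V p * (w' p - w p)) φ
        = divPairing (fun p => ρ p * w' p) (fun p => ρ p * V p * w' p) φ
          - divPairing (fun p => ρ p * w p) (fun p => ρ p * V p * w p) φ := by
      have hi : ∀ {u : ℝ × ℝ → ℝ}, IsBoundedField u → Integrable (fun p =>
          ρ p * u p * fderiv ℝ φ p (1, 0) + ρ p * V p * u p * fderiv ℝ φ p (0, 1))
          (volume.restrict halfPlane) := fun hu =>
        ((hρ.fun_mul_top hu).integrable_mul_of_top (integrable_fderiv_apply h _).restrict).add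
          (((hρ.fun_mul_top hV).fun_mul_top hu).integrable_mul_of_top
            (integrable_fderiv_apply h _).restrict)
      unfold divPairing
      rw [← integral_sub (hi hb') (hi hb)]
      refine integral_congr_ae (Eventually.of_forall fun p => ?_)
      ring
    rw [e2]
    linarith [hφ φ h, hφ' φ h])
  refine ae_restrict_halfPlane_iff.2 (key.mono fun p hp h0 hne => ?_)
  exact sub_eq_zero.1 ((mul_eq_zero.1 (hp h0)).resolve_left hne)

/-! ### The strictly ordered family of curves and the conclusion. -/

theorem timeInterval_top (t : ℝ) : timeInterval t ⊤ = Ici t := by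
  ext s
  simp [timeInterval, EReal.coe_lt_top]

/-- Level curves of the stream function at finitely many nondecreasing levels can be completed to a
strictly ordered family of Lipschitz curves: repeated levels are replaced by shifted copies, and
levels below the range of the stream function by vertical lines to the left of all others. -/
theorem exists_ordered_family {H : ℝ × ℝ → ℝ} {R : ℝ≥0} (hR : LipschitzWith R H) {L : ℝ≥0}
    (hmono : ∀ t, 0 ≤ t → ∀ x y, x ≤ y → H (t, x) ≤ H (t, y))
    (hanti : ∀ t, 0 ≤ t → ∀ x s, 0 ≤ s → H (t + s, x) ≤ H (t, x))
    (hspeed : ∀ t, 0 ≤ t → ∀ x s, 0 ≤ s → H (t, x) ≤ H (t + s, x + L * s))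
    {M : ℕ} {d : Fin M → ℝ} (hd : StrictMono d) :
    ∃ y : Fin M → ℝ → ℝ, IsOrderedLipschitzFamily (fun _ => 0) (fun _ => ⊤) y ∧
      ∀ m, (∀ p ∈ halfPlane, H (0, d m) ≤ H p) ∨
        ∃ n, ∀ p ∈ halfPlane, H (0, d m) ≤ H p ↔ y n p.1 ≤ p.2 := by
  classical
  let h : Fin M → ℝ := fun m => H (0, d m)
  have hh : ∀ m n, m ≤ n → h m ≤ h n := fun m n hmn => hmono 0 le_rfl _ _ (hd.monotone hmn)
  -- Only levels satisfying `P` have a curve; other levels lie below all values of `H`, or at their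
  -- infimum.
  let P : ℝ → Prop := fun u => ∃ x, H (0, x) < u
  have hY : ∀ u, ∃ Y : ℝ → ℝ, P u → (∃ x, u ≤ H (0, x)) →
      LipschitzOnWith L Y (Ici 0) ∧ (∀ s, 0 ≤ s → Y 0 ≤ Y s) ∧
      (∀ s, 0 ≤ s → H (s, Y s) = u) ∧ ∀ s, 0 ≤ s → ∀ x, u ≤ H (s, x) ↔ Y s ≤ x := by
    intro u
    by_cases h1 : P u ∧ ∃ x, u ≤ H (0, x)
    · obtain ⟨Y, hY⟩ := exists_level_curve hR.continuous hmono hanti hspeed h1.1 h1.2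
      exact ⟨Y, fun _ _ => hY⟩
    · exact ⟨0, fun h2 h3 => absurd ⟨h2, h3⟩ h1⟩
  choose Y hY using hY
  have hup : ∀ m, ∃ x, h m ≤ H (0, x) := fun m => ⟨d m, le_rfl⟩
  -- The vertical lines at `c + m` with `m < M` stay left of every level curve, since level curves
  -- never go left of their starting points.
  obtain ⟨c, hc⟩ := (Set.finite_range fun m => Y (h m) 0 - (M : ℝ)).bddBelow
  have hc' : ∀ m, c + M ≤ Y (h m) 0 := fun m => by
    have : c ≤ Y (h m) 0 - M := hc ⟨m, rfl⟩
    linarith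
  -- As `H` is `R`-Lipschitz, curves of distinct levels are separated by at least the level gap over
  -- `R`; shifts of at most `ε * M` cannot close that gap.
  obtain ⟨ε, hε, hε0⟩ : ∃ ε : ℝ, (∀ m n, h m < h n → R * (ε * M) < h n - h m) ∧ 0 < ε := by
    have h1 : ∀ᶠ ε : ℝ in 𝓝[>] 0, ∀ m n, h m < h n → R * (ε * M) < h n - h m := by
      refine eventually_all.2 fun m => eventually_all.2 fun n => ?_
      by_cases hmn : h m < h n
      · have h2 : Tendsto (fun ε : ℝ => R * (ε * M)) (𝓝[>] 0) (𝓝 (R * (0 * M))) :=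
          (Continuous.tendsto (by fun_prop) 0).mono_left nhdsWithin_le_nhds
        rw [zero_mul, mul_zero] at h2
        filter_upwards [h2.eventually_lt_const (sub_pos.2 hmn)] with ε hε _ using hε
      · exact Eventually.of_forall fun ε h' => absurd h' hmn
    exact (h1.and self_mem_nhdsWithin).exists
  -- The number of earlier indices with the same level, used as the number of `ε`-shifts.
  let r : Fin M → ℕ := fun m => (Finset.univ.filter fun j => j < m ∧ h j = h m).card
  have hrM : ∀ m, (r m : ℝ) ≤ M := fun m => by
    have := (Finset.univ.filter fun j => j < m ∧ h j = h m).card_le_univ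
    rw [Fintype.card_fin] at this
    exact_mod_cast this
  have hr_lt : ∀ m n, m < n → h m = h n → r m < r n := by
    intro m n hmn he
    refine Finset.card_lt_card ((Finset.ssubset_iff_of_subset ?_).2 ⟨m, ?_, ?_⟩)
    · intro j hj
      simp only [Finset.mem_filter, Finset.mem_univ, true_and] at hj ⊢
      exact ⟨hj.1.trans hmn, hj.2.trans he⟩
    · simpa using ⟨hmn, he⟩
    · simp
  let y : Fin M → ℝ → ℝ := fun m s => if P (h m) then Y (h m) s + ε * r m else c + m
  have hypos : ∀ m, P (h m) → ∀ s, y m s = Y (h m) s + ε * r m := fun m hm s => if_pos hm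
  have hyneg : ∀ m, ¬ P (h m) → ∀ s, y m s = c + m := fun m hm s => if_neg hm
  refine ⟨y, ⟨fun _ => le_rfl, fun _ => EReal.coe_lt_top _, fun m => ?_, ?_⟩, fun m => ?_⟩
  · rw [timeInterval_top]
    by_cases hm : P (h m)
    · refine ⟨L, LipschitzOnWith.of_dist_le_mul fun s hs t ht => ?_⟩
      rw [hypos m hm, hypos m hm, dist_add_right]
      exact (hY _ hm (hup m)).1.dist_le_mul s hs t ht
    · refine ⟨0, LipschitzOnWith.of_dist_le_mul fun s hs t ht => ?_⟩
      rw [hyneg m hm, hyneg m hm]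
      simp
  · intro m n hmn s hs
    rw [timeInterval_top, inter_self] at hs
    have hs0 : (0 : ℝ) ≤ s := hs
    by_cases hm : P (h m)
    · have hn : P (h n) := hm.imp fun x hx => hx.trans_le (hh m n hmn.le)
      rw [hypos m hm, hypos n hn]
      rcases (hh m n hmn.le).eq_or_lt with he | hlt
      · have : (r m : ℝ) < r n := by exact_mod_cast hr_lt m n hmn he
        rw [he]
        exact add_lt_add_right (mul_lt_mul_of_pos_left this hε0) _
      · obtain ⟨-, -, hYm, hYm'⟩ := hY _ hm (hup m)
        obtain ⟨-, -, hYn, hYn'⟩ := hY _ hn (hup n)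
        have h1 : Y (h m) s < Y (h n) s := by
          by_contra! hle
          have := (hYn' s hs0 _).2 hle
          rw [hYm s hs0] at this
          exact absurd this (not_le.2 hlt)
        have h2 := hR.dist_le_mul (s, Y (h n) s) (s, Y (h m) s)
        rw [hYm s hs0, hYn s hs0, Real.dist_eq, abs_of_pos (sub_pos.2 hlt), Prod.dist_eq, dist_self,
          max_eq_right dist_nonneg, Real.dist_eq, abs_of_pos (sub_pos.2 h1)] at h2
        have h3 := lt_of_mul_lt_mul_left ((hε m n hlt).trans_le h2) R.coe_nonneg
        have h4 : ε * r m ≤ ε * M := mul_le_mul_of_nonneg_left (hrM m) hε0.le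
        have h5 : 0 ≤ ε * r n := by positivity
        linarith
    · rw [hyneg m hm]
      by_cases hn : P (h n)
      · rw [hypos n hn]
        have h1 := (hY _ hn (hup n)).2.1 s hs0
        have h2 : ((m : ℕ) : ℝ) < M := by exact_mod_cast m.2
        have h3 : 0 ≤ ε * r n := by positivity
        linarith [hc' n]
      · rw [hyneg n hn]
        have : ((m : ℕ) : ℝ) < (n : ℕ) := by exact_mod_cast hmn
        linarith
  · by_cases hm : P (h m)
    · right
      have hne : (Finset.univ.filter fun j => h j = h m).Nonempty := ⟨m, by simp⟩
      -- The first index with this level has shift 0, so its curve is the true level curve.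
      let n := (Finset.univ.filter fun j => h j = h m).min' hne
      have hn : h n = h m := (Finset.mem_filter.1 (Finset.min'_mem _ hne)).2
      have hrn : r n = 0 := by
        refine Finset.card_eq_zero.2 (Finset.filter_eq_empty_iff.2 fun j _ hj => ?_)
        refine absurd (Finset.min'_le (Finset.univ.filter fun j => h j = h m) j ?_) (not_le.2 hj.1)
        simpa using hj.2.trans hn
      refine ⟨n, fun p hp => ?_⟩
      rw [hypos n (hn ▸ hm), hrn, hn, Nat.cast_zero, mul_zero, add_zero]
      exact (hY _ hm (hup m)).2.2.2 p.1 hp.1 p.2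
    · left
      intro p hp
      have h1 : ∀ x, h m ≤ H (0, x) := fun x => by
        by_contra! hlt
        exact hm ⟨x, hlt⟩
      -- Every point is reached from time 0 by a line of speed `L`, along which `H` does not
      -- decrease.
      have h2 := hspeed 0 le_rfl (p.2 - L * p.1) p.1 hp.1
      rw [zero_add, sub_add_cancel] at h2
      exact (h1 _).trans h2

/-- The side of a continuous graph does not change along connected subsets of its complement. -/
theorem le_iff_le_of_isPreconnected {C : Set (ℝ × ℝ)} (hC : IsPreconnected C) {y : ℝ → ℝ}
    {I : Set ℝ} (hy : ContinuousOn y I) (hCI : ∀ p ∈ C, p.1 ∈ I) (hne : ∀ p ∈ C, p.2 ≠ y p.1)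
    {p q : ℝ × ℝ} (hp : p ∈ C) (hq : q ∈ C) : y p.1 ≤ p.2 ↔ y q.1 ≤ q.2 := by
  have hcont : ContinuousOn (fun z : ℝ × ℝ => z.2 - y z.1) C :=
    continuousOn_snd.sub (hy.comp continuousOn_fst hCI)
  have key : ∀ p ∈ C, ∀ q ∈ C, y p.1 ≤ p.2 → y q.1 ≤ q.2 := by
    intro p hp q hq h
    by_contra! hlt
    obtain ⟨z, hz, hz0⟩ := hC.intermediate_value hq hp hcont
      ⟨(sub_neg.2 hlt).le, sub_nonneg.2 h⟩
    exact hne z hz (sub_eq_zero.1 hz0)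
  exact ⟨key p hp q hq, key q hq p hp⟩

theorem theorem3 (ρ V : ℝ × ℝ → ℝ)
    (hρ : IsBoundedField ρ) (hV : IsBoundedField V)
    (hρ_nonneg : ∀ᵐ p ∂(volume.restrict halfPlane), 0 ≤ ρ p)
    (hV_nonneg : ∀ᵐ p ∂(volume.restrict halfPlane), 0 ≤ V p)
    (hdiv : IsDivergenceFree ρ V)
    (M : ℕ) (hM : 1 ≤ M) (d : Fin M → ℝ) (a : Fin (M + 1) → ℝ) (w₀ : ℝ → ℝ)
    (hw₀ : IsStepFunction d a w₀) :
    ∃ (w : ℝ × ℝ → ℝ) (t : Fin M → ℝ) (T : Fin M → EReal) (y : Fin M → ℝ → ℝ),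
      IsWeakSolution ρ V w₀ w ∧
      (∀ w' : ℝ × ℝ → ℝ, IsWeakSolution ρ V w₀ w' →
        ∀ᵐ p ∂(volume.restrict halfPlane), ρ p ≠ 0 → w' p = w p) ∧
      IsOrderedLipschitzFamily t T y ∧
      IsConstantOnComponents (halfPlane \ ⋃ m, curve (t m) (T m) (y m)) w := by
  obtain ⟨H, hH⟩ := exists_isStreamFunction hρ (hρ.fun_mul_top hV) hdiv
  obtain ⟨L, hL⟩ := exists_ae_bound_of_memLp_top hV
  obtain ⟨R, hR⟩ := hH.lipschitz
  have hm := fun t (ht : (0 : ℝ) ≤ t) => hH.monotonicity (ae_restrict_halfPlane_iff.1 hρ_nonneg)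
    (ae_restrict_halfPlane_iff.1 hV_nonneg) (ae_restrict_halfPlane_iff.1 hL) ht
  obtain ⟨y, hy, hlevel⟩ := exists_ordered_family hR (fun t ht => (hm t ht).1)
    (fun t ht => (hm t ht).2.1) (fun t ht => (hm t ht).2.2) hw₀.ordered
  have hw := hH.isWeakSolution (hm 0 le_rfl).1 hw₀
  refine ⟨_, fun _ => 0, fun _ => ⊤, y, hw, fun w' hw' => ?_, hy, ?_⟩
  · exact hw.ae_eq hρ hV hρ_nonneg hV_nonneg hH hw'
  · intro p hp q hq
    have hsub := connectedComponentIn_subset (halfPlane \ ⋃ m, curve 0 ⊤ (y m)) p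
    -- `w` depends on a point only through which of these inequalities hold, and a component never
    -- crosses a level curve.
    have hiff : ∀ m, H (0, d m) ≤ H q ↔ H (0, d m) ≤ H p := by
      intro m
      rcases hlevel m with h | ⟨n, h⟩
      · exact iff_of_true (h q (hsub hq).1) (h p hp.1)
      · obtain ⟨K, hK⟩ := hy.lipschitz n
        rw [timeInterval_top] at hK
        rw [h q (hsub hq).1, h p hp.1]
        refine le_iff_le_of_isPreconnected isPreconnected_connectedComponentIn hK.continuousOn
          (fun z hz => (hsub hz).1.1) (fun z hz he => (hsub hz).2 ?_) hq
          (mem_connectedComponentIn hp)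
        refine mem_iUnion.2 ⟨n, z.1, ?_, ?_⟩
        · rw [timeInterval_top]
          exact (hsub hz).1.1
        · exact Prod.ext rfl he.symm
    simp only [jumpSum, hiff]
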